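/- Let $K$ be a (finite abstract) simplicial complex, i.e. a finite collection of non-empty finite sets such that every non-empty subset of a member of $K$ is again a member of $K$; a simplex $\sigma\in K$ has dimension $|\sigma|-1$, and $K_p$ denotes the set of simplices of dimension $p$. For $a,b\in\mathbb R^k$ write $a\preceq b$ if $a_i\le b_i$ for all $i$, and $a\precneqq b$ if $a\preceq b$ and $a\ne b$. For $f:K\to\mathbb R^k$ and $\sigma\in K_p$ put $$H_f(\sigma)=\{\beta\in K_{p+1} : \beta\supset\sigma,\ f(\beta)\preceq f(\sigma)\},\qquad T_f(\sigma)=\{\alpha\in K_{p-1} : \alpha\subset\sigma,\ f(\alpha)\succeq f(\sigma)\}.$$ The function $f$ is called a multidimensional discrete Morse (mdm) function if for every $p$ and every $\sigma\in K_p$: (1) $|H_f(\sigma)|\le 1$; (2) $|T_f(\sigma)|\le 1$; (3) if $\beta\in K_{p+1}$, $\beta\supset\sigma$ and $\beta\notin H_f(\sigma)$, then $f(\beta)\succneqq f(\sigma)$; (4) if $\alpha\in K_{p-1}$, $\alpha\subset\sigma$ and $\alpha\notin T_f(\sigma)$, then $f(\alpha)\precneqq f(\sigma)$. A simplex $\sigma\in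 K_p$ is a critical simplex of index $p$ of $f$ if $|H_f(\sigma)|=|T_f(\sigma)|=0$, and $m_p(f)$ denotes the number of critical simplices of index $p$. **Proposition.** If $f:K\to\mathbb R^k$ is an mdm function, then (the geometric realization of) $K$ is homotopy equivalent to a CW complex that has, for every $p\ge 0$, exactly $m_p(f)$ cells of dimension $p$. -/

import Mathlib

/-!
Discrete Morse theory for vector-valued functions on finite simplicial complexes.

An abstract simplicial complex `K` on a vertex type `ι` is Mathlib's `PreAbstractSimplicialComplex`:
a collection of non-empty finite sets that is closed under passing to non-empty subsets (it does not
have to contain every singleton of `ι`). A simplex `σ` has dimension `σ.card - 1`. The partial order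
on `Fin k → ℝ` is the coordinatewise one.
-/

universe u

namespace MultiMorse

variable {ι : Type*} {K : PreAbstractSimplicialComplex ι} {k : ℕ}

/-- `β` is a cofacet of `σ` (equivalently `σ` is a facet of `β`): `σ ⊆ β` and
`dim β = dim σ + 1`. -/
def IsCofacet (σ β : K) : Prop :=
  (σ : Finset ι) ⊆ (β : Finset ι) ∧ (β : Finset ι).card = (σ : Finset ι).card + 1

/-- `H_f(σ)`: the cofacets `β` of `σ` with `f β ⪯ f σ`. -/
def headSet (f : K → (Fin k → ℝ)) (σ : K) : Set K :=
  {β | IsCofacet σ β ∧ f β ≤ f σ}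

/-- `T_f(σ)`: the facets `α` of `σ` with `f α ⪰ f σ`. -/
def tailSet (f : K → (Fin k → ℝ)) (σ : K) : Set K :=
  {α | IsCofacet α σ ∧ f σ ≤ f α}

/-- Multidimensional discrete Morse (mdm) functions `f : K → ℝ^k`. On `Fin k → ℝ`, `a < b` means
`a ⪯ b` and `a ≠ b`. -/
structure IsMDM (f : K → (Fin k → ℝ)) : Prop where
  encard_headSet_le (σ : K) : (headSet f σ).encard ≤ 1
  encard_tailSet_le (σ : K) : (tailSet f σ).encard ≤ 1
  lt_of_notMem_headSet (σ β : K) : IsCofacet σ β → β ∉ headSet f σ → f σ < f β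
  lt_of_notMem_tailSet (σ α : K) : IsCofacet α σ → α ∉ tailSet f σ → f α < f σ

/-- A simplex is critical if `H_f(σ)` and `T_f(σ)` both have cardinality zero. -/
def IsCritical (f : K → (Fin k → ℝ)) (σ : K) : Prop :=
  (headSet f σ).encard = 0 ∧ (tailSet f σ).encard = 0

/-- `m_p(f)`: the number of critical simplices of dimension `p` (meaningful for finite `K`). -/
noncomputable def numCritical (f : K → (Fin k → ℝ)) (p : ℕ) : ℕ :=
  {σ : K | IsCritical f σ ∧ (σ : Finset ι).card = p + 1}.ncard

/-- The geometric realization of `K` in barycentric coordinates: the union over all simplices `s`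
of `K` of the standard simplex spanned by the basis vectors indexed by `s`. For finite `K`, which is
the only case used, the topology induced from `ι → ℝ` is the usual topology of `|K|`. -/
def realization (K : PreAbstractSimplicialComplex ι) : Set (ι → ℝ) :=
  {x | ∃ s ∈ K, (∀ i, 0 ≤ x i) ∧ (∀ i, i ∉ s → x i = 0) ∧ ∑ i ∈ s, x i = 1}

end MultiMorse

/-! The pairs `(σ, β)` with `β ∈ H_f(σ)` form an acyclic matching on the face poset of `K`, whose
unmatched simplices are the critical ones. If `σ` is matched with `t` and `s ≠ σ` is another facet
of `t`, then `f s < f t ≤ f σ`, so `f` strictly decreases along gradient paths. Hence `K` can be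
built from the empty complex by attaching critical simplices and by elementary expansions along
matched pairs (`DiscreteGradient.exists_peel`). An expansion keeps the homotopy type; a critical
simplex contributes one cell.

The CW complex is realized concretely as the image of a map `h` from the polyhedron to `Finset ι → ι
→ ℝ`, built along this filtration (`MorseMap`). Over an expansion, `h` is precomposed with the
collapse. Over a critical simplex `σ`, the old map is extended by Tietze and the so far unused
coordinate `σ` is set to `minCoord σ x • x`. This coordinate vanishes on the old polyhedron and is
injective on the open simplex, so the new open cell is embedded and disjoint from the old image.

That `h` remains a homotopy equivalence onto its image is a gluing statement: in a pushout along a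
map with the homotopy extension property, the pushout of a homotopy equivalence is one
(`IsGluing.exists_homotopyEquiv`). Cell boundaries lie in lower cells because `h` sends each
saturated subcomplex into the union of the critical cells it contains; this is applied to
`isSaturated_skeleton`. -/

namespace MultiMorse

open Topology unitInterval ContinuousMap

/-! ### Mapping spaces and homotopy equivalences -/

section Precomposition

variable {A X Z : Type*} [TopologicalSpace A] [TopologicalSpace X] [TopologicalSpace Z]

/-- Precomposition with a continuous map, as a continuous map of mapping spaces. -/
def precomp (Z : Type*) [TopologicalSpace Z] (f : C(A, X)) : C(C(X, Z), C(A, Z)) :=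
  ⟨fun v => v.comp f, ContinuousMap.continuous_precomp f⟩

/-- A homotopy between maps induces a homotopy between the precomposition maps. -/
theorem precomp_homotopic [LocallyCompactSpace A] [LocallyCompactSpace X] {f g : C(A, X)}
    (H : f.Homotopic g) : (precomp Z f).Homotopic (precomp Z g) := by
  obtain ⟨H⟩ := H
  refine ⟨⟨⟨fun p => p.2.comp (H.toContinuousMap.curry p.1), ?_⟩, ?_, ?_⟩⟩
  · exact continuous_snd.compCM ((H.toContinuousMap.curry.continuous).comp continuous_fst)
  · intro v; ext a; simp [precomp]
  · intro v; ext a; simp [precomp]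

/-- Precomposition with a homotopy equivalence is a homotopy equivalence of mapping spaces. -/
def precompEquiv (Z : Type*) [TopologicalSpace Z] [LocallyCompactSpace A] [LocallyCompactSpace X]
    (e : HomotopyEquiv A X) : HomotopyEquiv C(X, Z) C(A, Z) where
  toFun := precomp Z e.toFun
  invFun := precomp Z e.invFun
  left_inv := precomp_homotopic e.right_inv
  right_inv := precomp_homotopic e.left_inv

/-- A homotopy equivalence lifts paths up to homotopy relative to the end points. -/
theorem exists_path_map_homotopic (e : HomotopyEquiv A X) {x y : A} (F : Path (e x) (e y)) :
    ∃ G : Path x y, (G.map e.continuous).Homotopic F := by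
  -- A homotopy equivalence induces an equivalence of fundamental groupoids; fullness is exactly the
  -- lifting of path classes.
  have : (FundamentalGroupoid.map e.toFun).Full :=
    inferInstanceAs (FundamentalGroupoidFunctor.equivOfHomotopyEquiv e).functor.Full
  obtain ⟨q, hq⟩ := (FundamentalGroupoid.map e.toFun).map_surjective (X := ⟨x⟩) (Y := ⟨y⟩)
    (@Path.Homotopic.Quotient.mk _ _ (e x) (e y) F)
  obtain ⟨G, rfl⟩ := Path.Homotopic.Quotient.mk_surjective q
  exact ⟨G, Path.Homotopic.Quotient.exact hq⟩

end Precomposition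

/-! ### The homotopy extension property -/

section HomotopyExtension

variable {A B Z : Type*} [TopologicalSpace A] [TopologicalSpace B] [TopologicalSpace Z]

/-- `I × B` retracts onto `0 × B ∪ I × A`, where `A` is embedded in `B` by `i`. -/
def HasCylinderRetraction (i : A → B) : Prop :=
  ∃ ρ : C(I × B, I × B), (∀ b, ρ (0, b) = (0, b)) ∧ (∀ t a, ρ (t, i a) = (t, i a)) ∧
    ∀ p, (ρ p).1 = 0 ∨ (ρ p).2 ∈ Set.range i

/-- The homotopy extension property. -/
theorem HasCylinderRetraction.exists_extension {i : A → B} (hi : IsClosedEmbedding i)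
    (hρ : HasCylinderRetraction i) (u : C(B, Z)) (F : C(I × A, Z)) (hF : ∀ a, F (0, a) = u (i a)) :
    ∃ F' : C(I × B, Z), (∀ b, F' (0, b) = u b) ∧ ∀ t a, F' (t, i a) = F (t, a) := by
  classical
  obtain ⟨ρ, h0, hA, hρ⟩ := hρ
  let e := hi.isEmbedding.toHomeomorph
  -- `G` only has to be continuous on the union of the closed sets `{t = 0}` and `I × i(A)`, where
  -- it is pasted from `u` and `F`; the retraction `ρ` lands there, so `G ∘ ρ` is continuous.
  let G : I × B → Z := fun p => if h : p.2 ∈ Set.range i then F (p.1, e.symm ⟨p.2, h⟩) else u p.2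
  have hG1 : ∀ t a, G (t, i a) = F (t, a) := by
    intro t a
    have : e.symm ⟨i a, ⟨a, rfl⟩⟩ = a := by rw [e.symm_apply_eq]; rfl
    simp [G, this]
  have hG0 : ∀ b, G (0, b) = u b := by
    intro b
    by_cases hb : b ∈ Set.range i
    · obtain ⟨a, rfl⟩ := hb
      rw [hG1, hF]
    · exact dif_neg hb
  have hc0 : ContinuousOn G {p | p.1 = 0} := by
    refine (u.continuous.comp continuous_snd).continuousOn.congr ?_
    rintro ⟨t, b⟩ (rfl : t = 0)
    exact hG0 b
  have hc1 : ContinuousOn G {p | p.2 ∈ Set.range i} := by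
    rw [continuousOn_iff_continuous_domRestrict]
    have : Continuous fun p : {p : I × B | p.2 ∈ Set.range i} =>
        F (p.1.1, e.symm ⟨p.1.2, p.2⟩) := by fun_prop
    refine this.congr ?_
    rintro ⟨⟨t, b⟩, hb⟩
    have hG : G (t, b) = F (t, e.symm ⟨b, hb⟩) := dif_pos (c := b ∈ Set.range i) hb
    exact hG.symm
  have hc := hc0.union_of_isClosed hc1 (isClosed_singleton.preimage continuous_fst)
    (hi.isClosed_range.preimage continuous_snd)
  refine ⟨⟨G ∘ ρ, hc.comp_continuous ρ.continuous hρ⟩, fun b => ?_, fun t a => ?_⟩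
  · simp [h0, hG0]
  · simp [hA, hG1]

end HomotopyExtension

/-! ### Gluing along a homotopy equivalence -/

section Gluing

variable {A B X Y : Type u} [TopologicalSpace A] [TopologicalSpace B] [TopologicalSpace X]
  [TopologicalSpace Y]

/-- Homotopies that are compatible with a quotient map descend. -/
theorem homotopic_of_comp_quotient {Z : Type*} [TopologicalSpace Z] {q : C(B, Y)}
    (hq : IsQuotientMap q) (v₀ v₁ : C(Y, Z)) (F : C(I × B, Z)) (h₀ : ∀ b, F (0, b) = v₀ (q b))
    (h₁ : ∀ b, F (1, b) = v₁ (q b)) (hF : ∀ t x y, q x = q y → F (t, x) = F (t, y)) :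
    v₀.Homotopic v₁ := by
  -- In curried form the homotopy descends along `q` itself, so `I × B → I × Y` need not be shown to
  -- be a quotient map.
  let F₁ : C(B, C(I, Z)) := (F.comp ⟨Prod.swap, continuous_swap⟩).curry
  have hF₁ : ∀ x y, q x = q y → F₁ x = F₁ y := fun x y h => by
    ext t; exact hF t x y h
  let G : C(Y, C(I, Z)) := hq.lift F₁ hF₁
  have hG : ∀ b t, G (q b) t = F (t, b) := fun b t => by
    have : G (q b) = F₁ b := congrArg (fun f : C(B, C(I, Z)) => f b) (hq.lift_comp F₁ hF₁)
    rw [this]; rfl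
  refine ⟨⟨⟨fun p => G p.2 p.1, by fun_prop⟩, fun y => ?_, fun y => ?_⟩⟩
  · obtain ⟨b, rfl⟩ := hq.surjective y
    exact (hG b 0).trans (h₀ b)
  · obtain ⟨b, rfl⟩ := hq.surjective y
    exact (hG b 1).trans (h₁ b)

variable {i : C(A, B)} {j : C(X, Y)} {h : HomotopyEquiv A X} {q : C(B, Y)}

/-- The square `A → B → Y`, `A → X → Y` is a pushout along a map that has the homotopy extension
property, in a form convenient for a quotient map `B → Y`. -/
structure IsGluing (i : C(A, B)) (j : C(X, Y)) (h : C(A, X)) (q : C(B, Y)) : Prop where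
  isClosedEmbedding : IsClosedEmbedding i
  retraction : HasCylinderRetraction i
  comm : ∀ a, j (h a) = q (i a)
  isQuotientMap : IsQuotientMap q
  fiber : ∀ x y, q x = q y → x = y ∨ ∃ a b, i a = x ∧ i b = y ∧ h a = h b

theorem IsGluing.exists_lift {h : C(A, X)} (H : IsGluing i j h q) {Z : Type*} [TopologicalSpace Z]
    (u : C(B, Z)) (w : C(X, Z)) (huw : ∀ a, u (i a) = w (h a)) : ∃ v : C(Y, Z), v.comp q = u := by
  refine ⟨H.isQuotientMap.lift u fun x y hxy => ?_, H.isQuotientMap.lift_comp _ _⟩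
  rcases H.fiber x y hxy with rfl | ⟨a, b, rfl, rfl, hab⟩
  · rfl
  · rw [huw, huw, hab]

/-- Every map on `B` extends over `Y` up to homotopy. -/
theorem IsGluing.exists_comp_homotopic (H : IsGluing i j h.toFun q) {Z : Type*}
    [TopologicalSpace Z] (u : C(B, Z)) : ∃ v : C(Y, Z), (v.comp q).Homotopic u := by
  obtain ⟨K⟩ := h.left_inv
  -- This homotopy deforms `u ∘ i` to `u ∘ i ∘ h⁻¹ ∘ h`, which factors through `X`. Once it is
  -- extended over `B`, its end map is constant on the fibres of `q`.
  let F : C(I × A, Z) := (u.comp i).comp K.symm.toContinuousMap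
  obtain ⟨F', hF0, hF1⟩ := H.retraction.exists_extension H.isClosedEmbedding u F
    (fun a => by simp [F])
  obtain ⟨v, hv⟩ := H.exists_lift (F'.curry 1) ((u.comp i).comp h.invFun)
    (fun a => by simp [hF1, F])
  refine ⟨v, ?_⟩
  rw [hv]
  exact ContinuousMap.Homotopic.symm ⟨⟨F', fun b => by simp [hF0], fun b => by simp⟩⟩

variable [LocallyCompactSpace A] [LocallyCompactSpace B] [LocallyCompactSpace X]

/-- Homotopies can be pulled back along `B → Y`. -/
theorem IsGluing.homotopic_of_comp (H : IsGluing i j h.toFun q) {Z : Type*} [TopologicalSpace Z]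
    (v₀ v₁ : C(Y, Z)) (hv : (v₀.comp q).Homotopic (v₁.comp q)) : v₀.Homotopic v₁ := by
  obtain ⟨F⟩ := hv
  have hcomm : ∀ v : C(Y, Z), (v.comp j).comp h.toFun = (v.comp q).comp i := fun v => by
    ext a; simp [H.comm]
  -- Restricted to `A`, the homotopy is a path in `C(A, Z)` between maps pulled back from `X`. It
  -- need not come from `X` itself, but it is homotopic rel end points, by `S`, to the pullback of a
  -- path `G` in `C(X, Z)`.
  let FA : Path (precompEquiv Z h (v₀.comp j)) (precompEquiv Z h (v₁.comp j)) :=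
    { toFun := fun t => (F.toContinuousMap.curry t).comp i
      continuous_toFun := (ContinuousMap.continuous_precomp i).comp (map_continuous _)
      source' := by ext a; simpa [precompEquiv, precomp] using congrArg v₀ (H.comm a).symm
      target' := by ext a; simpa [precompEquiv, precomp] using congrArg v₁ (H.comm a).symm }
  obtain ⟨G, ⟨S⟩⟩ := exists_path_map_homotopic (precompEquiv Z h) FA
  have hS0 : ∀ t a, S.symm (0, t) a = F (t, i a) := fun t a => by
    rw [S.symm.apply_zero]; rfl
  have hS1 : ∀ t a, S.symm (1, t) a = G t (h a) := fun t a => by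
    rw [S.symm.apply_one]; rfl
  have hSl : ∀ s a, S.symm (s, 0) a = v₀ (j (h a)) := fun s a => by
    rw [S.symm.source]; rfl
  have hSr : ∀ s a, S.symm (s, 1) a = v₁ (j (h a)) := fun s a => by
    rw [S.symm.target]; rfl
  let S₁ : C(I × I, C(A, Z)) := S.symm.toContinuousMap
  let S₂ : C(I × A, C(I, Z)) :=
    ContinuousMap.curry ⟨fun p => S₁ (p.1.1, p.2) p.1.2, by fun_prop⟩
  let F₂ : C(B, C(I, Z)) := ContinuousMap.curry ⟨fun p => F (p.2, p.1), by fun_prop⟩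
  -- `T` extends `S` over `B`, giving a square of maps on `B` with `F` on the side `s = 0`. On each
  -- of the other three sides the restriction to `A` factors through `h`, so these sides descend to
  -- `Y` and compose to a homotopy from `v₀` to `v₁`.
  obtain ⟨T, hT0, hT1⟩ := H.retraction.exists_extension H.isClosedEmbedding F₂ S₂ (fun a => by
    ext t; exact hS0 t a)
  have hT0' : ∀ b t, T (0, b) t = F (t, b) := fun b t => by rw [hT0]; rfl
  have hT1' : ∀ s a t, T (s, i a) t = S.symm (s, t) a := fun s a t => by rw [hT1]; rfl
  have key : ∀ f : C(B, Z), ∀ w : C(X, Z), (∀ a, f (i a) = w (h a)) → ∀ x y, q x = q y →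
      f x = f y := by
    intro f w hf x y hxy
    rcases H.fiber x y hxy with rfl | ⟨a, b, rfl, rfl, hab⟩
    · rfl
    · rw [hf, hf]; exact congrArg w hab
  let ev : ∀ s t, C(B, Z) := fun s t => ⟨fun b => T (s, b) t, by fun_prop⟩
  obtain ⟨w₀, hw₀⟩ := H.exists_lift (ev 1 0) (v₀.comp j) (fun a => (hT1' 1 a 0).trans (hSl 1 a))
  obtain ⟨w₁, hw₁⟩ := H.exists_lift (ev 1 1) (v₁.comp j) (fun a => (hT1' 1 a 1).trans (hSr 1 a))
  have hw₀' : ∀ b, w₀ (q b) = T (1, b) 0 := fun b => congrArg (fun f : C(B, Z) => f b) hw₀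
  have hw₁' : ∀ b, w₁ (q b) = T (1, b) 1 := fun b => congrArg (fun f : C(B, Z) => f b) hw₁
  have h1 : v₀.Homotopic w₀ := homotopic_of_comp_quotient H.isQuotientMap v₀ w₀
    ⟨fun p => T (p.1, p.2) 0, by fun_prop⟩ (fun b => by simp [hT0'])
    (fun b => by simp [hw₀'])
    (fun s => key (ev s 0) (v₀.comp j) fun a => (hT1' s a 0).trans (hSl s a))
  have h2 : w₀.Homotopic w₁ := homotopic_of_comp_quotient H.isQuotientMap w₀ w₁
    ⟨fun p => T (1, p.2) p.1, by fun_prop⟩ (fun b => by simp [hw₀'])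
    (fun b => by simp [hw₁'])
    (fun t => key (ev 1 t) (G t) fun a => (hT1' 1 a t).trans (hS1 t a))
  have h3 : v₁.Homotopic w₁ := homotopic_of_comp_quotient H.isQuotientMap v₁ w₁
    ⟨fun p => T (p.1, p.2) 1, by fun_prop⟩ (fun b => by simp [hT0'])
    (fun b => by simp [hw₁'])
    (fun s => key (ev s 1) (v₁.comp j) fun a => (hT1' s a 1).trans (hSr s a))
  exact (h1.trans h2).trans h3.symm

/-- Gluing along a homotopy equivalence yields a homotopy equivalence. -/
theorem IsGluing.exists_homotopyEquiv (H : IsGluing i j h.toFun q) :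
    ∃ e : HomotopyEquiv B Y, e.toFun = q := by
  obtain ⟨g, hg⟩ := H.exists_comp_homotopic (ContinuousMap.id B)
  refine ⟨⟨q, g, hg, H.homotopic_of_comp _ _ ?_⟩, rfl⟩
  simpa [ContinuousMap.comp_assoc] using (ContinuousMap.Homotopic.refl q).comp hg

end Gluing

end MultiMorse

namespace MultiMorse

open Topology ContinuousMap

open scoped Classical

/-! ### Polyhedra in barycentric coordinates -/

section Simplices

variable {ι : Type*} {L M : Set (Finset ι)} {s t σ τ : Finset ι} {x : ι → ℝ}

/-- The closed simplex spanned by the basis vectors indexed by `s`. -/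
def closedSimplex (s : Finset ι) : Set (ι → ℝ) :=
  {x | (∀ i, 0 ≤ x i) ∧ (∀ i, i ∉ s → x i = 0) ∧ ∑ i ∈ s, x i = 1}

/-- The open simplex spanned by the basis vectors indexed by `s`. -/
def openSimplex (s : Finset ι) : Set (ι → ℝ) :=
  {x | x ∈ closedSimplex s ∧ ∀ i ∈ s, 0 < x i}

/-- The union of the closed simplices that belong to `L`. -/
def polyhedron (L : Set (Finset ι)) : Set (ι → ℝ) :=
  {x | ∃ s ∈ L, x ∈ closedSimplex s}

theorem closedSimplex_subset_polyhedron (hs : s ∈ L) : closedSimplex s ⊆ polyhedron L :=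
  fun _ h => ⟨s, hs, h⟩

theorem polyhedron_mono (h : L ⊆ M) : polyhedron L ⊆ polyhedron M :=
  fun _ ⟨s, hs, hx⟩ => ⟨s, h hs, hx⟩

theorem closedSimplex_mono (h : s ⊆ t) : closedSimplex s ⊆ closedSimplex t := by
  rintro x ⟨h0, hs, h1⟩
  refine ⟨h0, fun i hi => hs i fun h' => hi (h h'), ?_⟩
  rw [← h1]
  exact (Finset.sum_subset h fun i _ hi => hs i hi).symm

theorem isClosed_closedSimplex (s : Finset ι) : IsClosed (closedSimplex s) := by
  have : closedSimplex s = (⋂ i, {x | 0 ≤ x i}) ∩ (⋂ i, ⋂ (_ : i ∉ s), {x | x i = 0}) ∩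
      {x | ∑ i ∈ s, x i = 1} := by
    ext x; simp [closedSimplex, and_assoc]
  rw [this]
  refine ((isClosed_iInter fun i => isClosed_le (by fun_prop) (by fun_prop)).inter
    (isClosed_iInter fun i => isClosed_iInter fun _ =>
      isClosed_eq (by fun_prop) (by fun_prop))).inter (isClosed_eq (by fun_prop) (by fun_prop))

theorem le_one_of_mem_closedSimplex (hx : x ∈ closedSimplex s) (i : ι) : x i ≤ 1 := by
  by_cases hi : i ∈ s
  · rw [← hx.2.2]
    exact Finset.single_le_sum (fun j _ => hx.1 j) hi
  · rw [hx.2.1 i hi]; exact zero_le_one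

theorem isCompact_closedSimplex (s : Finset ι) : IsCompact (closedSimplex s) :=
  (isCompact_univ_pi fun _ : ι => isCompact_Icc (a := (0 : ℝ)) (b := 1)).of_isClosed_subset
    (isClosed_closedSimplex s) fun _ hx i _ => ⟨hx.1 i, le_one_of_mem_closedSimplex hx i⟩

theorem isCompact_polyhedron (hL : L.Finite) : IsCompact (polyhedron L) := by
  have : polyhedron L = ⋃ s ∈ L, closedSimplex s := by ext x; simp [polyhedron]
  rw [this]
  exact hL.isCompact_biUnion fun s _ => isCompact_closedSimplex s

/-- The support of a point of a simplex. -/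
theorem exists_mem_openSimplex (hx : x ∈ closedSimplex s) :
    ∃ t ⊆ s, t.Nonempty ∧ x ∈ openSimplex t ∧ ∀ i, 0 < x i → i ∈ t := by
  obtain ⟨h0, hs, h1⟩ := hx
  have hsub : s.filter (fun i => 0 < x i) ⊆ s := Finset.filter_subset _ _
  have hzero : ∀ i, i ∉ s.filter (fun i => 0 < x i) → x i = 0 := by
    intro i hi
    by_cases his : i ∈ s
    · exact le_antisymm (not_lt.1 fun h => hi (Finset.mem_filter.2 ⟨his, h⟩)) (h0 i)
    · exact hs i his
  have hsum : ∑ i ∈ s.filter (fun i => 0 < x i), x i = 1 := by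
    rw [← h1]
    exact Finset.sum_subset hsub fun i _ hi => hzero i hi
  refine ⟨s.filter (fun i => 0 < x i), hsub, ?_, ⟨⟨h0, hzero, hsum⟩, fun i hi =>
    (Finset.mem_filter.1 hi).2⟩, fun i hi => ?_⟩
  · rw [Finset.nonempty_iff_ne_empty]
    intro h
    rw [h, Finset.sum_empty] at hsum
    exact zero_ne_one hsum
  · by_contra h
    exact hi.ne' (hzero i h)

/-- `L` is closed under passing to non-empty subsets and consists of non-empty sets. -/
abbrev IsComplex (L : Set (Finset ι)) : Prop := IsRelLowerSet L Finset.Nonempty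

theorem IsComplex.mem_of_subset (hL : IsComplex L) (hs : s ∈ L) (ht : t.Nonempty) (h : t ⊆ s) :
    t ∈ L := (hL hs).2 h ht

theorem IsComplex.nonempty (hL : IsComplex L) (hs : s ∈ L) : s.Nonempty := (hL hs).1

theorem IsComplex.mem_of_pos (hL : IsComplex L) (hx : x ∈ polyhedron L) (ht : t.Nonempty)
    (h : ∀ i ∈ t, 0 < x i) : t ∈ L := by
  obtain ⟨s, hs, hxs⟩ := hx
  refine hL.mem_of_subset hs ht fun i hi => ?_
  by_contra his
  exact (h i hi).ne' (hxs.2.1 i his)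

theorem nonneg_of_mem_polyhedron (hx : x ∈ polyhedron L) (i : ι) : 0 ≤ x i := by
  obtain ⟨s, _, hx⟩ := hx
  exact hx.1 i

/-- The smallest coordinate of `x` with index in `s`. -/
noncomputable def minCoord (s : Finset ι) (x : ι → ℝ) : ℝ :=
  if h : s.Nonempty then s.inf' h x else 0

theorem continuous_minCoord (s : Finset ι) : Continuous (minCoord s) := by
  by_cases h : s.Nonempty
  · exact (Continuous.finset_inf'_apply h fun i _ => continuous_apply i).congr
      fun x => by rw [minCoord, dif_pos h]
  · exact (continuous_const (y := (0 : ℝ))).congr fun x => by rw [minCoord, dif_neg h]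

theorem minCoord_le {i : ι} (hi : i ∈ s) (x : ι → ℝ) : minCoord s x ≤ x i := by
  rw [minCoord, dif_pos ⟨i, hi⟩]
  exact Finset.inf'_le _ hi

theorem exists_minCoord_eq (hs : s.Nonempty) (x : ι → ℝ) : ∃ i ∈ s, x i = minCoord s x := by
  rw [minCoord, dif_pos hs]
  obtain ⟨i, hi, h⟩ := Finset.exists_mem_eq_inf' hs x
  exact ⟨i, hi, h.symm⟩

theorem minCoord_nonneg (hs : s.Nonempty) (hx : ∀ i, 0 ≤ x i) : 0 ≤ minCoord s x := by
  obtain ⟨i, _, h⟩ := exists_minCoord_eq hs x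
  exact h ▸ hx i

theorem minCoord_pos (hs : s.Nonempty) (hx : x ∈ openSimplex s) : 0 < minCoord s x := by
  obtain ⟨i, hi, h⟩ := exists_minCoord_eq hs x
  exact h ▸ hx.2 i hi

/-- A positive minimum would put `s` inside the support of `x`. Consequently every deformation whose
size is controlled by `minCoord σ` fixes the polyhedron of a complex not containing `σ`. -/
theorem IsComplex.minCoord_eq_zero (hL : IsComplex L) (hs : s.Nonempty) (hsL : s ∉ L)
    (hx : x ∈ polyhedron L) : minCoord s x = 0 := by
  refine le_antisymm (not_lt.1 fun h => hsL ?_) (minCoord_nonneg hs (nonneg_of_mem_polyhedron hx))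
  exact hL.mem_of_pos hx hs fun i hi => h.trans_le (minCoord_le hi x)

theorem IsComplex.mem_polyhedron_insert (hL : IsComplex (insert σ L))
    (hx : x ∈ polyhedron (insert σ L)) : x ∈ openSimplex σ ∨ x ∈ polyhedron L := by
  obtain ⟨s, hs, hx⟩ := hx
  obtain ⟨t, hts, ht, hxt, -⟩ := exists_mem_openSimplex hx
  rcases hL.mem_of_subset hs ht hts with rfl | htL
  · exact .inl hxt
  · exact .inr ⟨t, htL, hxt.1⟩

theorem IsComplex.mem_polyhedron_of_zero (hL : IsComplex (insert σ L))
    (hx : x ∈ closedSimplex σ) {i : ι} (hi : i ∈ σ) (hxi : x i = 0) : x ∈ polyhedron L := by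
  rcases hL.mem_polyhedron_insert ⟨σ, .inl rfl, hx⟩ with h | h
  · exact absurd hxi (h.2 i hi).ne'
  · exact h

end Simplices

/-! ### Radial retraction and elementary collapse -/

section Retractions

variable {ι : Type*} {L : Set (Finset ι)} {σ τ : Finset ι} {v : ι}

/-- Pushing radially away from the barycentre of `σ` by the amount `c`. -/
noncomputable def radialPush (σ : Finset ι) (c : ℝ) (x : ι → ℝ) : ι → ℝ :=
  fun i => (x i - if i ∈ σ then c else 0) / (1 - σ.card * c)

theorem radialPush_zero (σ : Finset ι) (x : ι → ℝ) : radialPush σ 0 x = x := by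
  ext i; simp [radialPush]

theorem radialPush_mem {c : ℝ} {x : ι → ℝ} (hx : x ∈ closedSimplex σ) (hc : σ.card * c < 1)
    (hcm : c ≤ minCoord σ x) : radialPush σ c x ∈ closedSimplex σ := by
  have hpos : 0 < 1 - σ.card * c := by linarith
  refine ⟨fun i => div_nonneg ?_ hpos.le, fun i hi => ?_, ?_⟩
  · split_ifs with hi
    · exact sub_nonneg.2 (hcm.trans (minCoord_le hi x))
    · simpa using hx.1 i
  · simp [radialPush, hi, hx.2.1 i hi]
  · simp only [radialPush]
    rw [← Finset.sum_div, Finset.sum_sub_distrib, hx.2.2, Finset.sum_ite_mem, Finset.inter_self,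
      Finset.sum_const, nsmul_eq_mul, div_self hpos.ne']

/-- The inclusion of polyhedra. -/
def polyhedronInclusion {L M : Set (Finset ι)} (h : L ⊆ M) : C(polyhedron L, polyhedron M) :=
  ⟨Set.inclusion (polyhedron_mono h), continuous_inclusion _⟩

theorem isClosedEmbedding_polyhedronInclusion {L M : Set (Finset ι)} (h : L ⊆ M) (hL : L.Finite) :
    IsClosedEmbedding (polyhedronInclusion h) := by
  have : CompactSpace (polyhedron L) := isCompact_iff_compactSpace.1 (isCompact_polyhedron hL)
  exact (map_continuous (polyhedronInclusion h)).isClosedEmbedding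
    (Set.inclusion_injective (polyhedron_mono h))

/-- Attaching a simplex has the homotopy extension property. -/
theorem hasCylinderRetraction_insert (hL : IsComplex L) (hL' : IsComplex (insert σ L))
    (hσ : σ ∉ L) : HasCylinderRetraction (polyhedronInclusion (Set.subset_insert σ L)) := by
  have hne : σ.Nonempty := hL'.nonempty (.inl rfl)
  have hn : 0 < (σ.card : ℝ) := by exact_mod_cast hne.card_pos
  -- The push stops when a coordinate of `σ` reaches zero or, since time decreases by `2 * σ.card *
  -- c`, when time reaches zero. The factor 2 keeps `σ.card * c ≤ 1/2`, so the denominator in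
  -- `radialPush` stays positive.
  let c : unitInterval × (ι → ℝ) → ℝ := fun p => min (minCoord σ p.2) (p.1 / (2 * σ.card))
  have hcc : Continuous c := by
    have := continuous_minCoord σ
    exact (this.comp continuous_snd).min (by fun_prop)
  have hcle : ∀ p, 2 * (σ.card * c p) ≤ p.1 := fun p => by
    have : c p ≤ p.1 / (2 * σ.card) := min_le_right _ _
    rw [le_div_iff₀ (by positivity)] at this
    linarith
  have hc0 : ∀ t : unitInterval, ∀ x ∈ polyhedron (insert σ L), 0 ≤ c (t, x) := fun t x hx =>
    le_min (minCoord_nonneg hne (nonneg_of_mem_polyhedron hx)) (div_nonneg t.2.1 (by positivity))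
  have hcL : ∀ t : unitInterval, ∀ x ∈ polyhedron L, c (t, x) = 0 := fun t x hx => by
    simp only [c, hL.minCoord_eq_zero hne hσ hx]
    exact min_eq_left (div_nonneg t.2.1 (by positivity))
  have hlt : ∀ p, σ.card * c p < 1 := fun p => by
    have := hcle p
    have := p.1.2.2
    linarith
  have hmem : ∀ t : unitInterval, ∀ x ∈ polyhedron (insert σ L),
      radialPush σ (c (t, x)) x ∈ polyhedron (insert σ L) := by
    intro t x hx
    rcases hL'.mem_polyhedron_insert hx with h | h
    · exact ⟨σ, .inl rfl, radialPush_mem h.1 (hlt _) (min_le_left _ _)⟩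
    · rw [hcL t x h, radialPush_zero]
      exact hx
  have hI : ∀ t : unitInterval, ∀ x ∈ polyhedron (insert σ L), (t : ℝ) - 2 * (σ.card * c (t, x)) ∈ unitInterval := by
    intro t x hx
    have h1 := hcle (t, x)
    have h2 : 0 ≤ σ.card * c (t, x) := mul_nonneg hn.le (hc0 t x hx)
    have h3 := t.2.2
    exact ⟨by simpa using h1, by linarith⟩
  refine ⟨⟨fun p => (⟨p.1 - 2 * (σ.card * c (p.1, p.2)), hI p.1 p.2 p.2.2⟩,
    ⟨radialPush σ (c (p.1, p.2)) p.2, hmem p.1 p.2 p.2.2⟩), ?_⟩, ?_, ?_, ?_⟩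
  · have hcp : Continuous fun p : unitInterval × polyhedron (insert σ L) => c (p.1, p.2) := by fun_prop
    refine Continuous.prodMk (Continuous.subtype_mk (by fun_prop) _)
      (Continuous.subtype_mk (continuous_pi fun i => Continuous.div ?_ (by fun_prop)
        fun p => ?_) _)
    · have hx : Continuous fun p : unitInterval × polyhedron (insert σ L) => p.2.1 i :=
        (continuous_apply i).comp (continuous_subtype_val.comp continuous_snd)
      split_ifs <;> fun_prop
    · have := hlt (p.1, p.2)
      linarith
  · rintro ⟨x, hx⟩
    have : c (0, x) = 0 := le_antisymm (by
      have := hcle (0, x)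
      simp only [Set.Icc.coe_zero] at this
      by_contra hcon
      have := mul_pos hn (not_le.1 hcon)
      linarith) (hc0 0 x hx)
    ext <;> simp [this, radialPush_zero]
  · rintro t ⟨x, hx⟩
    have : c (t, (polyhedronInclusion (Set.subset_insert σ L) ⟨x, hx⟩ : ι → ℝ)) = 0 := hcL t x hx
    ext <;> simp [this, radialPush_zero]
  · rintro ⟨t, x, hx⟩
    rcases min_choice (minCoord σ x) (t / (2 * σ.card) : ℝ) with h | h
    · right
      suffices h' : radialPush σ (c (t, x)) x ∈ polyhedron L from ⟨⟨_, h'⟩, rfl⟩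
      rcases hL'.mem_polyhedron_insert hx with hx' | hx'
      · obtain ⟨i, hi, hxi⟩ := exists_minCoord_eq hne x
        refine hL'.mem_polyhedron_of_zero
          (radialPush_mem hx'.1 (hlt _) (min_le_left _ _)) hi ?_
        have hc : c (t, x) = x i := h.trans hxi.symm
        simp [radialPush, hi, hc]
      · rw [hcL t x hx', radialPush_zero]
        exact hx'
    · left
      have hc : c (t, x) = t / (2 * σ.card) := h
      ext
      simp only [ContinuousMap.coe_mk, hc, Set.Icc.coe_zero]
      field_simp
      ring

/-- Pushing from the free face `σ` towards the opposite vertex `v`. -/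
noncomputable def collapse (σ : Finset ι) (v : ι) (t : ℝ) (x : ι → ℝ) : ι → ℝ :=
  fun i => x i - (if i ∈ σ then t * minCoord σ x else 0) +
    if i = v then t * (σ.card * minCoord σ x) else 0

theorem continuous_collapse (σ : Finset ι) (v : ι) :
    Continuous fun p : ℝ × (ι → ℝ) => collapse σ v p.1 p.2 := by
  have := continuous_minCoord σ
  refine continuous_pi fun i => ?_
  unfold collapse
  split_ifs <;> fun_prop

theorem collapse_zero (σ : Finset ι) (v : ι) (x : ι → ℝ) : collapse σ v 0 x = x := by
  ext i; simp [collapse]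

theorem collapse_eq_self (v : ι) (t : ℝ) {x : ι → ℝ} (h : minCoord σ x = 0) :
    collapse σ v t x = x := by
  ext i; simp [collapse, h]

theorem collapse_mem (hv : v ∉ σ) (hne : σ.Nonempty) {t : ℝ} (ht0 : 0 ≤ t) (ht1 : t ≤ 1)
    {x : ι → ℝ} (hx : x ∈ closedSimplex (insert v σ)) :
    collapse σ v t x ∈ closedSimplex (insert v σ) := by
  have hm := minCoord_nonneg hne hx.1
  refine ⟨fun i => ?_, fun i hi => ?_, ?_⟩
  · unfold collapse
    have h1 : 0 ≤ t * (σ.card * minCoord σ x) := by positivity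
    have h2 : 0 ≤ x i - (if i ∈ σ then t * minCoord σ x else 0) := by
      split_ifs with hi
      · have := minCoord_le hi x
        nlinarith
      · simpa using hx.1 i
    split_ifs <;> split_ifs at h2 <;> linarith
  · have : i ≠ v ∧ i ∉ σ := by simpa using hi
    simp [collapse, this, hx.2.1 i hi]
  · have h1 := hx.2.2
    rw [Finset.sum_insert hv] at h1 ⊢
    have h2 : ∑ i ∈ σ, collapse σ v t x i = ∑ i ∈ σ, x i - σ.card * (t * minCoord σ x) := by
      rw [← nsmul_eq_mul, ← Finset.sum_const, ← Finset.sum_sub_distrib]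
      refine Finset.sum_congr rfl fun i hi => ?_
      have : i ≠ v := fun h => hv (h ▸ hi)
      simp [collapse, hi, this]
    rw [h2]
    simp only [collapse, hv, if_false, if_true]
    linarith

theorem collapse_mem_polyhedron (hv : v ∉ σ) (hne : σ.Nonempty) (hL : IsComplex L) (hσ : σ ∉ L)
    {t : ℝ} (ht0 : 0 ≤ t) (ht1 : t ≤ 1)
    {x : ι → ℝ} (hx : x ∈ polyhedron (insert (insert v σ) (insert σ L))) :
    collapse σ v t x ∈ polyhedron (insert (insert v σ) (insert σ L)) := by
  obtain ⟨s, rfl | rfl | hs, hxs⟩ := hx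
  · exact ⟨_, .inl rfl, collapse_mem hv hne ht0 ht1 hxs⟩
  · exact ⟨_, .inl rfl, collapse_mem hv hne ht0 ht1
      (closedSimplex_mono (Finset.subset_insert v _) hxs)⟩
  · rw [collapse_eq_self v t (hL.minCoord_eq_zero hne hσ ⟨s, hs, hxs⟩)]
    exact ⟨s, .inr (.inr hs), hxs⟩

/-- At time 1 the smallest `σ`-coordinate has become zero, so the support no longer contains `σ`; of
the faces of `insert v σ`, only that simplex and `σ` are outside `L`. -/
theorem collapse_one_mem_polyhedron (hv : v ∉ σ) (hne : σ.Nonempty) (hL : IsComplex L)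
    (hσ : σ ∉ L) (hL' : IsComplex (insert (insert v σ) (insert σ L)))
    {x : ι → ℝ} (hx : x ∈ polyhedron (insert (insert v σ) (insert σ L))) :
    collapse σ v 1 x ∈ polyhedron L := by
  have key : ∀ x ∈ closedSimplex (insert v σ), collapse σ v 1 x ∈ polyhedron L := by
    intro x hx
    obtain ⟨i, hi, hxi⟩ := exists_minCoord_eq hne x
    have hiv : i ≠ v := fun h => hv (h ▸ hi)
    have h0 : collapse σ v 1 x i = 0 := by simp [collapse, hi, hiv, hxi]
    obtain ⟨s, hs, hsne, hxs, -⟩ :=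
      exists_mem_openSimplex (collapse_mem hv hne zero_le_one le_rfl hx)
    have his : i ∉ s := fun h => (hxs.2 i h).ne' h0
    rcases hL'.mem_of_subset (.inl rfl) hsne hs with rfl | rfl | hsL
    · exact absurd (Finset.mem_insert_of_mem hi) his
    · exact absurd hi his
    · exact ⟨s, hsL, hxs.1⟩
  obtain ⟨s, rfl | rfl | hs, hxs⟩ := hx
  · exact key x hxs
  · exact key x (closedSimplex_mono (Finset.subset_insert v _) hxs)
  · rw [collapse_eq_self v 1 (hL.minCoord_eq_zero hne hσ ⟨s, hs, hxs⟩)]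
    exact ⟨s, hs, hxs⟩

end Retractions

end MultiMorse

namespace MultiMorse

open scoped Classical

/-! ### Acyclic matchings and peeling off simplices -/

section DiscreteGradient

variable {ι : Type*}

/-- An acyclic matching `P` on the face poset of the complex `K` with set `C` of unmatched simplices.
Acyclicity is witnessed by the potential `f`. -/
structure DiscreteGradient {V : Type*} [PartialOrder V] (K : Set (Finset ι))
    (P : Finset ι → Finset ι → Prop) (C : Set (Finset ι)) (f : Finset ι → V) : Prop where
  isComplex : IsComplex K
  right_mem {s t} : P s t → t ∈ K
  subset {s t} : P s t → s ⊆ t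
  card_eq {s t} : P s t → t.card = s.card + 1
  left_nonempty {s t} : P s t → s.Nonempty
  right_unique {s t t'} : P s t → P s t' → t = t'
  left_unique {s s' t} : P s t → P s' t → s = s'
  not_chain {s t r} : P s t → ¬P t r
  crit_subset : C ⊆ K
  crit_or {s} : s ∈ K → s ∈ C ∨ (∃ t, P s t) ∨ ∃ t, P t s
  crit_not_left {s t} : s ∈ C → ¬P s t
  crit_not_right {s t} : s ∈ C → ¬P t s
  lt {s s' t} : P s' t → s ⊆ t → t.card = s.card + 1 → s.Nonempty → s ≠ s' → f s < f s'

/-- A subcomplex that is closed under the matching. -/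
structure IsSaturated (P : Finset ι → Finset ι → Prop) (L : Set (Finset ι)) : Prop where
  isComplex : IsComplex L
  mem {s t} : P s t → s ∈ L → t ∈ L

namespace DiscreteGradient

variable {V : Type*} [PartialOrder V] {K : Set (Finset ι)} {P : Finset ι → Finset ι → Prop}
  {C : Set (Finset ι)} {f : Finset ι → V} (G : DiscreteGradient K P C f) {L : Set (Finset ι)}

include G

theorem isSaturated : IsSaturated P K := ⟨G.isComplex, fun h _ => G.right_mem h⟩

theorem left_mem (hL : IsSaturated P L) {s t : Finset ι} (h : P s t) (ht : t ∈ L) : s ∈ L :=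
  hL.isComplex.mem_of_subset ht (G.left_nonempty h) (G.subset h)

/-- The saturated subcomplex of simplices of dimension less than `n` and of those of dimension `n`
that are matched with a face. -/
theorem isSaturated_skeleton (n : ℕ) :
    IsSaturated P {s | s ∈ K ∧ (s.card ≤ n ∨ s.card = n + 1 ∧ ∃ t, P t s)} := by
  refine ⟨fun b hb => ⟨G.isComplex.nonempty hb.1, fun c hcb hc => ?_⟩, ?_⟩
  · refine ⟨G.isComplex.mem_of_subset hb.1 hc hcb, ?_⟩
    have hcard := Finset.card_le_card hcb
    rcases hb.2 with h | ⟨h, h'⟩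
    · exact .inl (hcard.trans h)
    · rcases eq_or_ne c b with rfl | hne
      · exact .inr ⟨h, h'⟩
      · have := Finset.card_lt_card (Finset.ssubset_iff_subset_ne.2 ⟨hcb, hne⟩)
        left
        omega
  · rintro s t hst ⟨hs, h | ⟨-, r, hr⟩⟩
    · refine ⟨G.right_mem hst, ?_⟩
      have := G.card_eq hst
      rcases Nat.lt_or_ge n t.card with h' | h'
      · exact .inr ⟨by omega, s, hst⟩
      · exact .inl h'
    · exact absurd hst (G.not_chain hr)

/-- A non-empty saturated finite complex arises from a smaller one by attaching a critical simplex
or by an elementary expansion along a matched pair. -/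
theorem exists_peel (hL : IsSaturated P L) (hLK : L ⊆ K) (hfin : L.Finite) (hne : L.Nonempty) :
    ∃ M, IsSaturated P M ∧
      ((∃ σ ∈ C, σ ∉ M ∧ L = insert σ M) ∨
        ∃ σ v, v ∉ σ ∧ P σ (insert v σ) ∧ σ ∉ M ∧
          L = insert (insert v σ) (insert σ M)) := by
  -- `s₀` has the largest dimension among the simplices not matched with a face. A simplex of larger
  -- dimension is matched with a face; that face is not itself matched with a face, so its dimension
  -- is exactly that of `s₀`.
  obtain ⟨s₀, ⟨hs₀L, hs₀⟩, hmax⟩ := Set.exists_max_image {s ∈ L | ∀ t, ¬P t s} Finset.card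
    (hfin.subset (Set.sep_subset _ _)) (by
      obtain ⟨s, hs⟩ := hne
      by_cases h : ∃ t, P t s
      · obtain ⟨t, ht⟩ := h
        exact ⟨t, G.left_mem hL ht hs, fun r hr => G.not_chain hr ht⟩
      · exact ⟨s, hs, not_exists.1 h⟩)
  have hhead : ∀ b ∈ L, s₀.card < b.card → ∃ s ∈ L, P s b ∧ s.card = s₀.card := by
    intro b hb hlt
    by_cases h : ∃ t, P t b
    · obtain ⟨t, ht⟩ := h
      have htL := G.left_mem hL ht hb
      have h1 := hmax t ⟨htL, fun r hr => G.not_chain hr ht⟩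
      have h2 := G.card_eq ht
      exact ⟨t, htL, ht, by omega⟩
    · exact absurd (hmax b ⟨hb, not_exists.1 h⟩) (not_le.2 hlt)
  by_cases hex : ∃ s ∈ L, s.card = s₀.card ∧ ∃ t, P s t
  · obtain ⟨s, ⟨⟨hsL, hsc, t, hst⟩, hsmax⟩⟩ :=
      Set.Finite.exists_maximalFor f {s ∈ L | s.card = s₀.card ∧ ∃ t, P s t}
        (hfin.subset (Set.sep_subset _ _)) hex
    have htL := hL.mem hst hsL
    have htc := G.card_eq hst
    obtain ⟨v, hv, rfl⟩ := Finset.exists_eq_insert_iff.2 ⟨G.subset hst, htc.symm⟩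
    refine ⟨L \ {insert v s, s}, ⟨fun b hb => ⟨hL.isComplex.nonempty hb.1, fun c hcb hc =>
      ⟨hL.isComplex.mem_of_subset hb.1 hc hcb, ?_⟩⟩, ?_⟩,
      .inr ⟨s, v, hv, hst, by simp, ?_⟩⟩
    · obtain ⟨hbL, hb⟩ := hb
      have hble : b.card ≤ s₀.card + 1 := by
        by_contra hlt
        obtain ⟨r, -, hr, hrc⟩ := hhead b hbL (by omega)
        have := G.card_eq hr
        omega
      rintro (rfl | rfl)
      · exact hb (.inl (Finset.eq_of_subset_of_card_le hcb (by omega)).symm)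
      · have hlt : c.card < b.card := Finset.card_lt_card
          (Finset.ssubset_iff_subset_ne.2 ⟨hcb, fun h => hb (.inr h.symm)⟩)
        obtain ⟨r, hrL, hr, hrc⟩ := hhead b hbL (by omega)
        have hne : c ≠ r := by
          rintro rfl
          exact hb (.inl (G.right_unique hr hst))
        have hlt' := G.lt hr hcb (by omega) hc hne
        exact hlt'.not_ge (hsmax ⟨hrL, hrc, b, hr⟩ hlt'.le)
    · rintro a b hab ⟨haL, ha⟩
      refine ⟨hL.mem hab haL, ?_⟩
      rintro (rfl | rfl)
      · exact ha (.inr (G.left_unique hab hst))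
      · exact G.not_chain hab hst
    · ext b
      by_cases h1 : b = insert v s
      · simp [h1, htL]
      · by_cases h2 : b = s
        · simp [h2, hsL]
        · simp [h1, h2]
  -- Now no simplex exceeds the dimension of `s₀`, so `s₀` is a maximal simplex, and it is
  -- unmatched.
  · have hs₀t : ∀ t, ¬P s₀ t := fun t ht => hex ⟨s₀, hs₀L, rfl, t, ht⟩
    have hs₀C : s₀ ∈ C := by
      rcases G.crit_or (hLK hs₀L) with h | ⟨t, h⟩ | ⟨t, h⟩
      · exact h
      · exact absurd h (hs₀t t)
      · exact absurd h (hs₀ t)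
    refine ⟨L \ {s₀}, ⟨fun b hb => ⟨hL.isComplex.nonempty hb.1, fun c hcb hc =>
      ⟨hL.isComplex.mem_of_subset hb.1 hc hcb, ?_⟩⟩, ?_⟩, .inl ⟨s₀, hs₀C, by simp, ?_⟩⟩
    · rintro rfl
      obtain ⟨hbL, hb⟩ := hb
      obtain ⟨r, hrL, hr, hrc⟩ := hhead b hbL (Finset.card_lt_card
        (Finset.ssubset_iff_subset_ne.2 ⟨hcb, fun h => hb h.symm⟩))
      exact hex ⟨r, hrL, hrc, b, hr⟩
    · rintro a b hab ⟨haL, ha⟩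
      refine ⟨hL.mem hab haL, ?_⟩
      rintro rfl
      exact hs₀ a hab
    · ext b
      by_cases h : b = s₀ <;> simp [h, hs₀L]

end DiscreteGradient

end DiscreteGradient

/-! ### The gradient of an mdm function -/

section MDM

variable {ι : Type*} {K : PreAbstractSimplicialComplex ι} {k : ℕ} {f : K → (Fin k → ℝ)}

theorem IsMDM.headSet_subsingleton (hf : IsMDM f) (σ : K) : (headSet f σ).Subsingleton :=
  Set.encard_le_one_iff_subsingleton.1 (hf.encard_headSet_le σ)

theorem IsMDM.tailSet_subsingleton (hf : IsMDM f) (σ : K) : (tailSet f σ).Subsingleton :=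
  Set.encard_le_one_iff_subsingleton.1 (hf.encard_tailSet_le σ)

/-- A simplex cannot be the head of one matched pair and the tail of another one. -/
theorem IsMDM.not_chain (hf : IsMDM f) {α σ β : K} (hα : α ∈ tailSet f σ) (hβ : β ∈ headSet f σ) :
    False := by
  obtain ⟨⟨hασ, hαc⟩, hαf⟩ := hα
  obtain ⟨⟨hσβ, hσc⟩, hβf⟩ := hβ
  obtain ⟨a, haα, haσ⟩ := Finset.exists_eq_insert_iff.2 ⟨hασ, hαc.symm⟩
  obtain ⟨b, hbσ, hbβ⟩ := Finset.exists_eq_insert_iff.2 ⟨hσβ, hσc.symm⟩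
  have hbα : b ∉ (α : Finset ι) := fun h => hbσ (hασ h)
  have hsub : insert b (α : Finset ι) ⊆ β := by
    rw [← hbβ]
    exact Finset.insert_subset_insert b hασ
  -- `σ'` is the other simplex strictly between `α` and `β`. Uniqueness of the matched pairs gives
  -- `f α < f σ' < f β ≤ f σ ≤ f α`.
  let σ' : K := ⟨insert b (α : Finset ι),
    (K.isRelLowerSet_faces β.2).2 hsub (Finset.insert_nonempty _ _)⟩
  have hne : σ' ≠ σ := by
    intro h
    have : b ∈ (σ' : Finset ι) := Finset.mem_insert_self _ _
    exact hbσ (h ▸ this)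
  have hcard : (σ' : Finset ι).card = (α : Finset ι).card + 1 := Finset.card_insert_of_notMem hbα
  have h1 : IsCofacet α σ' := ⟨Finset.subset_insert _ _, hcard⟩
  have h2 : IsCofacet σ' β := ⟨hsub, by omega⟩
  have h3 : f α < f σ' := hf.lt_of_notMem_headSet α σ' h1 fun h =>
    hne (hf.headSet_subsingleton α h ⟨⟨hασ, hαc⟩, hαf⟩)
  have h4 : f σ' < f β := hf.lt_of_notMem_tailSet β σ' h2 fun h =>
    hne (hf.tailSet_subsingleton β h ⟨⟨hσβ, hσc⟩, hβf⟩)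
  exact ((h3.trans h4).trans_le (hβf.trans hαf)).false

/-- The gradient pairs of `f`. -/
def gradientPair (f : K → (Fin k → ℝ)) (s t : Finset ι) : Prop :=
  ∃ σ τ : K, (σ : Finset ι) = s ∧ (τ : Finset ι) = t ∧ τ ∈ headSet f σ

/-- The critical simplices of `f`. -/
def criticalSimplices (f : K → (Fin k → ℝ)) : Set (Finset ι) :=
  {s | ∃ σ : K, (σ : Finset ι) = s ∧ IsCritical f σ}

/-- The potential is `f` itself; the value 0 off `K` is a placeholder, since `lt` compares only
non-empty faces of a simplex of `K`. -/
theorem IsMDM.discreteGradient (hf : IsMDM f) :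
    DiscreteGradient K.faces (gradientPair f) (criticalSimplices f)
      (fun s => if h : s ∈ K then f ⟨s, h⟩ else 0) where
  isComplex := K.isRelLowerSet_faces
  right_mem := by rintro _ _ ⟨σ, τ, rfl, rfl, -⟩; exact τ.2
  subset := by rintro _ _ ⟨σ, τ, rfl, rfl, h⟩; exact h.1.1
  card_eq := by rintro _ _ ⟨σ, τ, rfl, rfl, h⟩; exact h.1.2
  left_nonempty := by rintro _ _ ⟨σ, τ, rfl, rfl, -⟩; exact (K.isRelLowerSet_faces σ.2).1
  right_unique := by
    rintro _ _ _ ⟨σ, τ, rfl, rfl, h⟩ ⟨σ', τ', hσ, rfl, h'⟩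
    obtain rfl : σ' = σ := Subtype.ext hσ
    exact congrArg Subtype.val (hf.headSet_subsingleton _ h h')
  left_unique := by
    rintro _ _ _ ⟨σ, τ, rfl, rfl, h⟩ ⟨σ', τ', rfl, hτ, h'⟩
    obtain rfl : τ' = τ := Subtype.ext hτ
    exact congrArg Subtype.val (hf.tailSet_subsingleton _ h h')
  not_chain := by
    rintro _ _ _ ⟨σ, τ, rfl, rfl, h⟩ ⟨τ', ρ, hτ, rfl, h'⟩
    obtain rfl : τ' = τ := Subtype.ext hτ
    exact hf.not_chain h h'
  crit_subset := by rintro _ ⟨σ, rfl, -⟩; exact σ.2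
  crit_or := by
    intro s hs
    by_cases h1 : (headSet f ⟨s, hs⟩).Nonempty
    · obtain ⟨τ, hτ⟩ := h1
      exact .inr (.inl ⟨τ, ⟨s, hs⟩, τ, rfl, rfl, hτ⟩)
    by_cases h2 : (tailSet f ⟨s, hs⟩).Nonempty
    · obtain ⟨τ, hτ⟩ := h2
      exact .inr (.inr ⟨τ, τ, ⟨s, hs⟩, rfl, rfl, hτ⟩)
    rw [Set.not_nonempty_iff_eq_empty] at h1 h2
    exact .inl ⟨⟨s, hs⟩, rfl, by rw [h1, Set.encard_empty], by rw [h2, Set.encard_empty]⟩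
  crit_not_left := by
    rintro _ _ ⟨σ, rfl, hσ, -⟩ ⟨σ', τ, hσ', rfl, h⟩
    obtain rfl : σ' = σ := Subtype.ext hσ'
    rw [Set.encard_eq_zero] at hσ
    simp [hσ] at h
  crit_not_right := by
    rintro _ _ ⟨σ, rfl, -, hσ⟩ ⟨τ, σ', rfl, hσ', h⟩
    obtain rfl : σ' = σ := Subtype.ext hσ'
    rw [Set.encard_eq_zero] at hσ
    have : τ ∈ tailSet f σ' := h
    simp [hσ] at this
  lt := by
    rintro s _ _ ⟨σ, τ, rfl, rfl, h⟩ hs hcard hne hsσ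
    have hsK : s ∈ K := (K.isRelLowerSet_faces τ.2).2 hs hne
    have h1 : f ⟨s, hsK⟩ < f τ := hf.lt_of_notMem_tailSet τ ⟨s, hsK⟩ ⟨hs, hcard⟩ fun h' =>
      hsσ (congrArg Subtype.val (hf.tailSet_subsingleton τ h' h))
    have hσK : (σ : Finset ι) ∈ K := σ.2
    simp only [hsK, hσK, dif_pos]
    exact h1.trans_le h.2

end MDM

end MultiMorse

namespace MultiMorse

open Topology ContinuousMap

open scoped Classical

/-! ### Homotopy equivalences onto the image -/

section HomotopyEquivOn

variable {E F : Type u} [TopologicalSpace E] [TopologicalSpace F]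

/-- `h` restricts to a homotopy equivalence from `S` onto its image. -/
def IsHomotopyEquivOn (h : E → F) (S : Set E) : Prop :=
  ∃ e : HomotopyEquiv S (h '' S), ∀ x, (e x : F) = h x

theorem isHomotopyEquivOn_empty (h : E → F) : IsHomotopyEquivOn h ∅ := by
  have : IsEmpty (h '' ∅) := by simp
  refine ⟨⟨⟨fun x => x.2.elim, continuous_of_const fun x => x.2.elim⟩,
    ⟨fun x => isEmptyElim x, continuous_of_const fun x => isEmptyElim x⟩, ?_, ?_⟩, fun x => x.2.elim⟩
  · rw [Subsingleton.elim (ContinuousMap.comp _ _) (ContinuousMap.id _)]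
  · rw [Subsingleton.elim (ContinuousMap.comp _ _) (ContinuousMap.id _)]

theorem IsHomotopyEquivOn.comp {h : E → F} {S S' : Set E} (hh : IsHomotopyEquivOn h S)
    (e : HomotopyEquiv S' S) {r : E → E} (her : ∀ x, (e x : E) = r x) (hr : r '' S' = S) :
    IsHomotopyEquivOn (h ∘ r) S' := by
  obtain ⟨e₂, he₂⟩ := hh
  have him : h '' S = (h ∘ r) '' S' := by rw [Set.image_comp, hr]
  refine ⟨(e.trans e₂).trans (Homeomorph.setCongr him).toHomotopyEquiv, fun x => ?_⟩
  exact (he₂ (e x)).trans (congrArg h (her x))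

end HomotopyEquivOn

/-! ### Construction of the Morse map -/

section MorseMap

variable {ι : Type u} {L M : Set (Finset ι)} {σ : Finset ι} {v : ι}

/-- An elementary collapse is a homotopy equivalence. -/
theorem exists_homotopyEquiv_collapse (hv : v ∉ σ) (hM : IsComplex M) (hσ : σ ∉ M)
    (hL : IsComplex (insert (insert v σ) (insert σ M))) :
    ∃ e : HomotopyEquiv (polyhedron (insert (insert v σ) (insert σ M))) (polyhedron M),
      ∀ x, (e x : ι → ℝ) = collapse σ v 1 x := by
  have hne : σ.Nonempty := hL.nonempty (.inr (.inl rfl))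
  have hc := continuous_collapse σ v
  have hsub : M ⊆ insert (insert v σ) (insert σ M) := fun _ h => .inr (.inr h)
  let r : C(polyhedron (insert (insert v σ) (insert σ M)), polyhedron M) :=
    ⟨fun x => ⟨collapse σ v 1 x, collapse_one_mem_polyhedron hv hne hM hσ hL x.2⟩,
      Continuous.subtype_mk (hc.comp (by fun_prop : Continuous fun x :
        polyhedron (insert (insert v σ) (insert σ M)) => ((1 : ℝ), (x : ι → ℝ)))) _⟩
  refine ⟨⟨r, polyhedronInclusion hsub, ?_, ?_⟩, fun x => rfl⟩
  · refine ContinuousMap.Homotopic.symm ⟨⟨⟨fun p => ⟨collapse σ v p.1 p.2,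
      collapse_mem_polyhedron hv hne hM hσ p.1.2.1 p.1.2.2 p.2.2⟩,
      Continuous.subtype_mk (hc.comp (by fun_prop : Continuous fun p : unitInterval ×
        polyhedron (insert (insert v σ) (insert σ M)) => ((p.1 : ℝ), (p.2 : ι → ℝ)))) _⟩, ?_, ?_⟩⟩
    · intro x
      exact Subtype.ext (collapse_zero σ v x)
    · intro x
      rfl
  · convert ContinuousMap.Homotopic.refl _
    ext x : 1
    exact (Subtype.ext (collapse_eq_self v 1 (hM.minCoord_eq_zero hne hσ x.2))).symm

/-- Barycentric coordinates sum to 1, so the coordinate sum recovers the scalar. -/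
theorem eq_of_smul_eq_smul {x y : ι → ℝ} {a b : ℝ} (hx : x ∈ closedSimplex σ)
    (hy : y ∈ closedSimplex σ) (ha : a ≠ 0) (h : a • x = b • y) : x = y := by
  have hab : a = b := by
    have := congrArg (fun z : ι → ℝ => ∑ i ∈ σ, z i) h
    simpa [← Finset.mul_sum, hx.2.2, hy.2.2] using this
  subst hab
  exact smul_right_injective _ ha h

theorem minCoord_smul_ne_zero {x : ι → ℝ} (hσ : σ.Nonempty) (hx : x ∈ openSimplex σ) :
    minCoord σ x • x ≠ 0 := by
  obtain ⟨i, hi⟩ := hσ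
  refine smul_ne_zero (minCoord_pos ⟨i, hi⟩ hx).ne' fun h => (hx.2 i hi).ne' ?_
  rw [h]; rfl

/-- A map from the polyhedron of `L` to a vector space whose image is a CW complex with the
critical simplices as cells, and which is a homotopy equivalence onto the image. -/
structure MorseMap (P : Finset ι → Finset ι → Prop) (C L : Set (Finset ι))
    (h : (ι → ℝ) → Finset ι → ι → ℝ) : Prop where
  continuousOn : ContinuousOn h (polyhedron L)
  apply_eq_zero {x s} : x ∈ polyhedron L → s ∉ L → h x s = 0
  apply_crit {x s} : s ∈ C → s ∈ L → x ∈ closedSimplex s → h x s = minCoord s x • x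
  disjoint {x y s t} : s ∈ C → s ∈ L → t ∈ C → t ∈ L → s ≠ t → x ∈ openSimplex s →
    y ∈ openSimplex t → h x ≠ h y
  exists_eq {N x} : IsSaturated P N → N ⊆ L → x ∈ polyhedron N →
    ∃ s ∈ C, s ∈ N ∧ ∃ y ∈ openSimplex s, h x = h y
  isHomotopyEquivOn : IsHomotopyEquivOn h (polyhedron L)

variable {V : Type*} [PartialOrder V] {K : Set (Finset ι)} {P : Finset ι → Finset ι → Prop}
  {C : Set (Finset ι)} {f : Finset ι → V} {h : (ι → ℝ) → Finset ι → ι → ℝ}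

theorem polyhedron_empty : polyhedron (∅ : Set (Finset ι)) = ∅ := by
  ext x; simp [polyhedron]

theorem morseMap_empty (P : Finset ι → Finset ι → Prop) (C : Set (Finset ι)) :
    MorseMap P C ∅ 0 where
  continuousOn := continuousOn_const
  apply_eq_zero _ _ := rfl
  apply_crit _ h := h.elim
  disjoint _ h := h.elim
  exists_eq _ hN hx := by
    obtain rfl := Set.subset_empty_iff.1 hN
    simp [polyhedron_empty] at hx
  isHomotopyEquivOn := polyhedron_empty (ι := ι) ▸ isHomotopyEquivOn_empty _

theorem IsSaturated.inter {N : Set (Finset ι)} (hN : IsSaturated P N) (hM : IsSaturated P M) :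
    IsSaturated P (N ∩ M) :=
  ⟨hN.isComplex.inter hM.isComplex, fun h hs => ⟨hN.mem h hs.1, hM.mem h hs.2⟩⟩

/-- Extension of a Morse map along an elementary expansion. -/
theorem MorseMap.comp_collapse (G : DiscreteGradient K P C f) (hM : IsSaturated P M)
    (hh : MorseMap P C M h) (hv : v ∉ σ) (hσv : P σ (insert v σ)) (hσ : σ ∉ M)
    (hL : IsSaturated P (insert (insert v σ) (insert σ M))) :
    MorseMap P C (insert (insert v σ) (insert σ M)) (h ∘ collapse σ v 1) := by
  have hne : σ.Nonempty := G.left_nonempty hσv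
  have hself : ∀ x ∈ polyhedron M, collapse σ v 1 x = x := fun x hx =>
    collapse_eq_self v 1 (hM.isComplex.minCoord_eq_zero hne hσ hx)
  have hmaps : ∀ x ∈ polyhedron (insert (insert v σ) (insert σ M)),
      collapse σ v 1 x ∈ polyhedron M := fun x =>
    collapse_one_mem_polyhedron hv hne hM.isComplex hσ hL.isComplex
  have hC : ∀ s ∈ C, s ∈ insert (insert v σ) (insert σ M) → s ∈ M := by
    rintro s hs (rfl | rfl | hsM)
    · exact absurd hσv (G.crit_not_right hs)
    · exact absurd hσv (G.crit_not_left hs)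
    · exact hsM
  have hCself : ∀ s ∈ C, s ∈ insert (insert v σ) (insert σ M) → ∀ x ∈ closedSimplex s,
      (h ∘ collapse σ v 1) x = h x := fun s hs hs' x hx =>
    congrArg h (hself x (closedSimplex_subset_polyhedron (hC s hs hs') hx))
  refine ⟨?_, ?_, ?_, ?_, ?_, ?_⟩
  · refine hh.continuousOn.comp (Continuous.continuousOn ?_) hmaps
    exact (continuous_collapse σ v).comp (by fun_prop : Continuous fun x : ι → ℝ => ((1 : ℝ), x))
  · exact fun hx hs => hh.apply_eq_zero (hmaps _ hx) fun h' => hs (.inr (.inr h'))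
  · intro x s hs hs' hx
    rw [hCself s hs hs' x hx]
    exact hh.apply_crit hs (hC s hs hs') hx
  · intro x y s t hs hs' ht ht' hst hx hy
    rw [hCself s hs hs' x hx.1, hCself t ht ht' y hy.1]
    exact hh.disjoint hs (hC s hs hs') ht (hC t ht ht') hst hx hy
  · intro N x hN hNL hx
    suffices hx' : collapse σ v 1 x ∈ polyhedron (N ∩ M) by
      obtain ⟨s, hs, hsN, y, hy, hxy⟩ := hh.exists_eq (hN.inter hM) Set.inter_subset_right hx'
      refine ⟨s, hs, hsN.1, y, hy, ?_⟩
      rw [hCself s hs (hNL hsN.1) y hy.1]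
      exact hxy
    -- Saturation leaves two cases: `N` contains the whole pair and is an expansion of `N ∩ M`, or
    -- it contains neither member and the collapse fixes its polyhedron.
    by_cases hσN : σ ∈ N
    · have hN' : N = insert (insert v σ) (insert σ (N ∩ M)) := by
        ext s
        constructor
        · intro hs
          rcases hNL hs with rfl | rfl | hsM
          · exact .inl rfl
          · exact .inr (.inl rfl)
          · exact .inr (.inr ⟨hs, hsM⟩)
        · rintro (rfl | rfl | hs)
          · exact hN.mem hσv hσN
          · exact hσN
          · exact hs.1
      rw [hN'] at hx
      exact collapse_one_mem_polyhedron hv hne (hN.inter hM).isComplex (fun h' => hσ h'.2)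
        (hN' ▸ hN.isComplex) hx
    · have hNM : N ⊆ M := by
        intro s hs
        rcases hNL hs with rfl | rfl | hsM
        · exact absurd (G.left_mem hN hσv hs) hσN
        · exact absurd hs hσN
        · exact hsM
      rw [Set.inter_eq_left.2 hNM, hself x (polyhedron_mono hNM hx)]
      exact hx
  · obtain ⟨e, he⟩ := exists_homotopyEquiv_collapse hv hM.isComplex hσ hL.isComplex
    refine hh.isHomotopyEquivOn.comp e he (Set.Subset.antisymm ?_ fun x hx => ?_)
    · rintro _ ⟨x, hx, rfl⟩
      exact hmaps x hx
    · exact ⟨x, polyhedron_mono (fun _ h' => .inr (.inr h')) hx, hself x hx⟩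

/-- Attaching a simplex to a homotopy equivalence onto the image. -/
theorem isHomotopyEquivOn_insert (hM : IsComplex M) (hMfin : M.Finite) (hσ : σ ∉ M)
    (hL : IsComplex (insert σ M)) {F : Type u} [TopologicalSpace F] [T2Space F]
    {h h' : (ι → ℝ) → F} (hh : IsHomotopyEquivOn h (polyhedron M))
    (hc : ContinuousOn h (polyhedron M)) (hc' : ContinuousOn h' (polyhedron (insert σ M)))
    (heq : Set.EqOn h' h (polyhedron M))
    (hfib : ∀ x ∈ openSimplex σ, ∀ y ∈ polyhedron (insert σ M), h' x = h' y → x = y) :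
    IsHomotopyEquivOn h' (polyhedron (insert σ M)) := by
  obtain ⟨e, he⟩ := hh
  have : CompactSpace (polyhedron M) := isCompact_iff_compactSpace.1 (isCompact_polyhedron hMfin)
  have : CompactSpace (polyhedron (insert σ M)) :=
    isCompact_iff_compactSpace.1 (isCompact_polyhedron (hMfin.insert σ))
  have : CompactSpace (h '' polyhedron M) :=
    isCompact_iff_compactSpace.1 ((isCompact_polyhedron hMfin).image_of_continuousOn hc)
  let q : C(polyhedron (insert σ M), h' '' polyhedron (insert σ M)) :=
    ⟨fun x => ⟨h' x, Set.mem_image_of_mem _ x.2⟩,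
      Continuous.subtype_mk (continuousOn_iff_continuous_domRestrict.1 hc') _⟩
  have hsub : h '' polyhedron M ⊆ h' '' polyhedron (insert σ M) := by
    rintro _ ⟨x, hx, rfl⟩
    exact ⟨x, polyhedron_mono (Set.subset_insert σ M) hx, heq hx⟩
  let j : C(h '' polyhedron M, h' '' polyhedron (insert σ M)) :=
    ⟨Set.inclusion hsub, continuous_inclusion hsub⟩
  have H : IsGluing (polyhedronInclusion (Set.subset_insert σ M)) j e.toFun q :=
    { isClosedEmbedding := isClosedEmbedding_polyhedronInclusion _ hMfin
      retraction := hasCylinderRetraction_insert hM hL hσ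
      comm := fun a => Subtype.ext ((he a).trans (heq a.2).symm)
      isQuotientMap := IsQuotientMap.of_surjective_continuous
        (fun ⟨_, x, hx, rfl⟩ => ⟨⟨x, hx⟩, rfl⟩) q.continuous
      fiber := by
        intro x y hxy
        have hxy' : h' x = h' y := congrArg Subtype.val hxy
        rcases hL.mem_polyhedron_insert x.2 with hx | hx
        · exact .inl (Subtype.ext (hfib x hx y y.2 hxy'))
        rcases hL.mem_polyhedron_insert y.2 with hy | hy
        · exact .inl (Subtype.ext (hfib y hy x x.2 hxy'.symm).symm)
        · refine .inr ⟨⟨x, hx⟩, ⟨y, hy⟩, rfl, rfl, Subtype.ext ?_⟩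
          refine (he ⟨x, hx⟩).trans (Eq.trans ?_ (he ⟨y, hy⟩).symm)
          rw [← heq hx, ← heq hy, hxy'] }
  obtain ⟨e', he'⟩ := H.exists_homotopyEquiv
  exact ⟨e', fun x => congrArg (fun g : C(polyhedron (insert σ M), h' '' polyhedron (insert σ M)) =>
    (g x : F)) he'⟩

/-- Extension of a Morse map over a critical simplex. -/
theorem MorseMap.exists_insert (hM : IsSaturated P M) (hMfin : M.Finite)
    (hh : MorseMap P C M h) (hσC : σ ∈ C) (hσ : σ ∉ M) (hL : IsSaturated P (insert σ M)) :
    ∃ h', MorseMap P C (insert σ M) h' := by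
  have hne : σ.Nonempty := hL.isComplex.nonempty (.inl rfl)
  have hsub : polyhedron M ⊆ polyhedron (insert σ M) := polyhedron_mono (Set.subset_insert σ M)
  have : CompactSpace (polyhedron M) := isCompact_iff_compactSpace.1 (isCompact_polyhedron hMfin)
  have : CompactSpace (polyhedron (insert σ M)) :=
    isCompact_iff_compactSpace.1 (isCompact_polyhedron (hMfin.insert σ))
  -- Any Tietze extension will do: on the open simplex `σ`, injectivity and separation from the old
  -- image come from the coordinate `σ` alone.
  obtain ⟨H, hH⟩ := ContinuousMap.exists_extension
    (isClosedEmbedding_polyhedronInclusion (Set.subset_insert σ M) hMfin)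
    (⟨_, continuousOn_iff_continuous_domRestrict.1 hh.continuousOn⟩ :
      C(polyhedron M, Finset ι → ι → ℝ))
  have hH' : ∀ x, ∀ hx : x ∈ polyhedron M, H ⟨x, hsub hx⟩ = h x := fun x hx =>
    congrArg (fun g : C(polyhedron M, Finset ι → ι → ℝ) => g ⟨x, hx⟩) hH
  let h' : (ι → ℝ) → Finset ι → ι → ℝ := fun x s =>
    if s = σ then minCoord σ x • x
    else if s ∈ M then (if hx : x ∈ polyhedron (insert σ M) then H ⟨x, hx⟩ s else 0) else 0
  have hσ' : ∀ x, h' x σ = minCoord σ x • x := fun x => if_pos rfl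
  have hm : ∀ x ∈ polyhedron M, minCoord σ x = 0 := fun x hx =>
    hM.isComplex.minCoord_eq_zero hne hσ hx
  have heq : Set.EqOn h' h (polyhedron M) := by
    intro x hx
    ext1 s
    by_cases hs : s = σ
    · subst hs
      rw [hσ', hm x hx, zero_smul, hh.apply_eq_zero hx hσ]
    · by_cases hsM : s ∈ M
      · simp only [h', hs, hsM, if_true, if_false, hsub hx, dif_pos, hH' x hx]
      · simp only [h', hs, hsM, if_false, hh.apply_eq_zero hx hsM]
  have hc' : ContinuousOn h' (polyhedron (insert σ M)) := by
    rw [continuousOn_iff_continuous_domRestrict]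
    refine continuous_pi fun s => ?_
    by_cases hs : s = σ
    · subst hs
      have := continuous_minCoord s
      have hc : Continuous fun x : polyhedron (insert s M) => minCoord s x • (x : ι → ℝ) := by
        fun_prop
      exact hc.congr fun x => (hσ' x).symm
    · by_cases hsM : s ∈ M
      · have hc : Continuous fun x => H x s := by fun_prop
        refine hc.congr fun x => ?_
        simp [h', hs, hsM]
      · refine (continuous_const (y := (0 : ι → ℝ))).congr fun x => ?_
        simp [h', hs, hsM]
  have hnew : ∀ x ∈ openSimplex σ, ∀ y ∈ polyhedron M, h' x ≠ h' y := by
    intro x hx y hy hxy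
    have := congrFun hxy σ
    rw [hσ', hσ', hm y hy, zero_smul] at this
    exact minCoord_smul_ne_zero hne hx this
  refine ⟨h', hc', ?_, ?_, ?_, ?_, ?_⟩
  · intro x s hx hs
    have h1 : s ≠ σ := fun h' => hs (.inl h')
    have h2 : s ∉ M := fun h' => hs (.inr h')
    simp [h', h1, h2]
  · rintro x s hs (rfl | hsM) hx
    · exact hσ' x
    · rw [heq (closedSimplex_subset_polyhedron hsM hx)]
      exact hh.apply_crit hs hsM hx
  · rintro x y s t hs (rfl | hsM) ht (rfl | htM) hst hx hy
    · exact absurd rfl hst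
    · exact hnew x hx y (closedSimplex_subset_polyhedron htM hy.1)
    · exact (hnew y hy x (closedSimplex_subset_polyhedron hsM hx.1)).symm
    · rw [heq (closedSimplex_subset_polyhedron hsM hx.1),
        heq (closedSimplex_subset_polyhedron htM hy.1)]
      exact hh.disjoint hs hsM ht htM hst hx hy
  · intro N x hN hNL hx
    obtain ⟨s, hs, hxs⟩ := hx
    obtain ⟨t, hts, ht, hxt, -⟩ := exists_mem_openSimplex hxs
    have htN := hN.isComplex.mem_of_subset hs ht hts
    rcases hNL htN with rfl | htM
    · exact ⟨t, hσC, htN, x, hxt, rfl⟩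
    · obtain ⟨r, hr, hrN, y, hy, hxy⟩ := hh.exists_eq (hN.inter hM) Set.inter_subset_right
        (closedSimplex_subset_polyhedron (⟨htN, htM⟩ : t ∈ N ∩ M) hxt.1)
      refine ⟨r, hr, hrN.1, y, hy, ?_⟩
      rw [heq (closedSimplex_subset_polyhedron htM hxt.1),
        heq (closedSimplex_subset_polyhedron hrN.2 hy.1), hxy]
  · refine isHomotopyEquivOn_insert hM.isComplex hMfin hσ hL.isComplex hh.isHomotopyEquivOn
      hh.continuousOn hc' heq fun x hx y hy hxy => ?_
    rcases hL.isComplex.mem_polyhedron_insert hy with hy' | hy'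
    · have := congrFun hxy σ
      rw [hσ', hσ'] at this
      exact eq_of_smul_eq_smul hx.1 hy'.1 (minCoord_pos hne hx).ne' this
    · exact absurd hxy (hnew x hx y hy')

/-- Induction on the number of simplices, with `exists_peel` supplying the smaller saturated
complex. -/
theorem DiscreteGradient.exists_morseMap (G : DiscreteGradient K P C f) (hK : K.Finite)
    (hL : IsSaturated P L) (hLK : L ⊆ K) : ∃ h, MorseMap P C L h := by
  induction hn : L.ncard using Nat.strong_induction_on generalizing L with
  | _ n ih =>
    have hfin : L.Finite := hK.subset hLK
    rcases L.eq_empty_or_nonempty with rfl | hne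
    · exact ⟨0, morseMap_empty P C⟩
    obtain ⟨M, hM, ⟨σ, hσC, hσ, rfl⟩ | ⟨σ, v, hv, hσv, hσ, rfl⟩⟩ :=
      G.exists_peel hL hLK hfin hne
    · have hsub := Set.subset_insert σ M
      obtain ⟨h, hh⟩ := ih M.ncard
        (hn ▸ Set.ncard_lt_ncard (Set.ssubset_insert hσ) hfin) hM (hsub.trans hLK) rfl
      exact hh.exists_insert hM (hfin.subset hsub) hσC hσ hL
    · have hsub : M ⊂ insert (insert v σ) (insert σ M) :=
        (Set.ssubset_insert hσ).trans_subset (Set.subset_insert _ _)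
      obtain ⟨h, hh⟩ := ih M.ncard
        (hn ▸ Set.ncard_lt_ncard hsub hfin) hM (hsub.subset.trans hLK) rfl
      exact ⟨_, hh.comp_collapse G hM hv hσv hσ hL⟩

end MorseMap

end MultiMorse

namespace MultiMorse

open Topology ContinuousMap Metric

open scoped Classical

/-! ### Parametrizing simplices by balls -/

section CharacteristicMap

variable {ι : Type*}

/-- The simplex in `ℝⁿ` cut out by the coordinate hyperplanes and the hyperplane `∑ xᵢ = 1`. -/
def cornerSimplex (n : ℕ) : Set (Fin n → ℝ) := {x | (∀ i, 0 ≤ x i) ∧ ∑ i, x i ≤ 1}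

/-- The interior of the corner simplex. -/
def openCornerSimplex (n : ℕ) : Set (Fin n → ℝ) := {x | (∀ i, 0 < x i) ∧ ∑ i, x i < 1}

theorem isOpen_openCornerSimplex (n : ℕ) : IsOpen (openCornerSimplex n) := by
  have : openCornerSimplex n = (⋂ i, {x | 0 < x i}) ∩ {x | ∑ i, x i < 1} := by
    ext x; simp [openCornerSimplex]
  rw [this]
  exact (isOpen_iInter_of_finite fun i => isOpen_lt (by fun_prop) (by fun_prop)).inter
    (isOpen_lt (by fun_prop) (by fun_prop))

theorem isClosed_cornerSimplex (n : ℕ) : IsClosed (cornerSimplex n) := by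
  have : cornerSimplex n = (⋂ i, {x | 0 ≤ x i}) ∩ {x | ∑ i, x i ≤ 1} := by
    ext x; simp [cornerSimplex]
  rw [this]
  exact (isClosed_iInter fun i => isClosed_le (by fun_prop) (by fun_prop)).inter
    (isClosed_le (by fun_prop) (by fun_prop))

theorem combo_mem_openCornerSimplex {n : ℕ} {x y : Fin n → ℝ} (hx : x ∈ cornerSimplex n)
    (hy : y ∈ openCornerSimplex n) {a b : ℝ} (ha : 0 ≤ a) (hb : 0 < b) (hab : a + b = 1) :
    a • x + b • y ∈ openCornerSimplex n := by
  refine ⟨fun i => ?_, ?_⟩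
  · have h1 := mul_nonneg ha (hx.1 i)
    have h2 := mul_pos hb (hy.1 i)
    simp only [Pi.add_apply, Pi.smul_apply, smul_eq_mul]
    linarith
  · have h1 := mul_le_mul_of_nonneg_left hx.2 ha
    have h2 := mul_lt_mul_of_pos_left hy.2 hb
    simp only [Pi.add_apply, Pi.smul_apply, smul_eq_mul, Finset.sum_add_distrib, ← Finset.mul_sum]
    linarith

theorem openCornerSimplex_subset (n : ℕ) : openCornerSimplex n ⊆ cornerSimplex n :=
  fun _ hx => ⟨fun i => (hx.1 i).le, hx.2.le⟩

theorem convex_openCornerSimplex (n : ℕ) : Convex ℝ (openCornerSimplex n) := by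
  rw [convex_iff_forall_pos]
  intro x hx y hy a b ha hb hab
  exact combo_mem_openCornerSimplex (openCornerSimplex_subset n hx) hy ha.le hb hab

theorem openCornerSimplex_nonempty (n : ℕ) : (openCornerSimplex n).Nonempty := by
  refine ⟨fun _ => 1 / (n + 1), fun i => by positivity, ?_⟩
  rw [Finset.sum_const, Finset.card_univ, Fintype.card_fin, nsmul_eq_mul, mul_one_div,
    div_lt_one (by positivity)]
  exact lt_add_one _

theorem closure_openCornerSimplex (n : ℕ) : closure (openCornerSimplex n) = cornerSimplex n := by
  refine (closure_minimal (openCornerSimplex_subset n) (isClosed_cornerSimplex n)).antisymm ?_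
  intro x hx
  obtain ⟨y, hy⟩ := openCornerSimplex_nonempty n
  refine closure_mono ?_ (segment_subset_closure_openSegment (left_mem_segment ℝ x y))
  rintro _ ⟨a, b, ha, hb, hab, rfl⟩
  exact combo_mem_openCornerSimplex hx hy ha.le hb hab

theorem isBounded_openCornerSimplex (n : ℕ) : Bornology.IsBounded (openCornerSimplex n) := by
  refine (isBounded_Icc (0 : Fin n → ℝ) 1).subset fun x hx => ⟨fun i => (hx.1 i).le, fun i => ?_⟩
  exact (Finset.single_le_sum (f := x) (fun j _ => (hx.1 j).le) (Finset.mem_univ i)).trans hx.2.le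

/-- A parametrization of an `n`-simplex by the unit ball of `ℝⁿ`. -/
theorem exists_ball_parametrization {s : Finset ι} {n : ℕ} (hs : s.card = n + 1) :
    ∃ (c : (Fin n → ℝ) → ι → ℝ) (d : (ι → ℝ) → Fin n → ℝ), Continuous c ∧ Continuous d ∧
      (∀ x, d (c x) = x) ∧ (∀ y ∈ closedSimplex s, c (d y) = y) ∧
      (∀ x, c x ∈ closedSimplex s ↔ x ∈ closedBall 0 1) ∧
      (∀ x, c x ∈ openSimplex s ↔ x ∈ ball 0 1) := by
  -- A bounded convex set with non-empty interior can be carried to the unit ball by a homeomorphism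
  -- of the whole space; the ball of `Fin n → ℝ` is a cube, the norm being the sup norm.
  obtain ⟨φ, hφ, hφ', -⟩ := exists_homeomorph_image_interior_closure_frontier_eq_unitBall
    (convex_openCornerSimplex n)
    ((isOpen_openCornerSimplex n).interior_eq.symm ▸ openCornerSimplex_nonempty n)
    (isBounded_openCornerSimplex n)
  rw [(isOpen_openCornerSimplex n).interior_eq] at hφ
  rw [closure_openCornerSimplex] at hφ'
  let e : Fin (n + 1) ≃ s := (s.equivFinOfCardEq hs).symm
  let c₀ : (Fin n → ℝ) → ι → ℝ := fun x j =>
    if h : j ∈ s then (Fin.cons (1 - ∑ i, x i) x : Fin (n + 1) → ℝ) (e.symm ⟨j, h⟩) else 0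
  let d₀ : (ι → ℝ) → Fin n → ℝ := fun y i => y (e i.succ)
  have hc₀e : ∀ x i, c₀ x (e i) = (Fin.cons (1 - ∑ i, x i) x : Fin (n + 1) → ℝ) i := by
    intro x i
    simp [c₀]
  have hsum : ∀ y : ι → ℝ, ∑ j ∈ s, y j = y (e 0) + ∑ i, d₀ y i := by
    intro y
    rw [← Finset.sum_coe_sort s y, ← e.sum_comp, Fin.sum_univ_succ]
  have hall : ∀ p : ι → Prop, (∀ j ∈ s, p j) ↔ p (e 0) ∧ ∀ i : Fin n, p (e i.succ) := by
    intro p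
    rw [← Fin.forall_fin_succ (P := fun i => p (e i))]
    constructor
    · exact fun h i => h _ (e i).2
    · intro h j hj
      simpa using h (e.symm ⟨j, hj⟩)
  have hdc : ∀ x, d₀ (c₀ x) = x := by
    intro x; ext i
    simp only [d₀, hc₀e, Fin.cons_succ]
  have hc0 : ∀ x, c₀ x (e 0) = 1 - ∑ i, x i := fun x => by rw [hc₀e, Fin.cons_zero]
  have hcs : ∀ x (i : Fin n), c₀ x (e i.succ) = x i := fun x i => by rw [hc₀e, Fin.cons_succ]
  have hout : ∀ x j, j ∉ s → c₀ x j = 0 := fun x j hj => dif_neg hj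
  have hcd : ∀ y ∈ closedSimplex s, c₀ (d₀ y) = y := by
    intro y hy
    have h1 := hsum y
    rw [hy.2.2] at h1
    have : ∀ j ∈ s, c₀ (d₀ y) j = y j := by
      rw [hall]
      exact ⟨by rw [hc0]; linarith, fun i => by rw [hcs]⟩
    ext j
    by_cases hj : j ∈ s
    · exact this j hj
    · rw [hout _ j hj, hy.2.1 j hj]
  have hclosed : ∀ x, c₀ x ∈ closedSimplex s ↔ x ∈ cornerSimplex n := by
    intro x
    constructor
    · intro h
      refine ⟨fun i => hcs x i ▸ h.1 _, ?_⟩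
      have := h.1 (e 0)
      rw [hc0] at this
      linarith
    · intro h
      have h0 : ∀ j ∈ s, 0 ≤ c₀ x j := by
        rw [hall]
        exact ⟨by rw [hc0]; linarith [h.2], fun i => by rw [hcs]; exact h.1 i⟩
      refine ⟨fun j => ?_, hout x, ?_⟩
      · by_cases hj : j ∈ s
        · exact h0 j hj
        · exact (hout x j hj).ge
      · rw [hsum, hdc, hc0]
        ring
  have hopen : ∀ x, c₀ x ∈ openSimplex s ↔ x ∈ openCornerSimplex n := by
    intro x
    constructor
    · intro h
      have h' := (hall _).1 h.2
      rw [hc0] at h'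
      exact ⟨fun i => hcs x i ▸ h'.2 i, by linarith [h'.1]⟩
    · intro h
      refine ⟨(hclosed x).2 (openCornerSimplex_subset n h), (hall _).2 ⟨?_, fun i => ?_⟩⟩
      · rw [hc0]; linarith [h.2]
      · rw [hcs]; exact h.1 i
  have hc₀c : Continuous c₀ := by
    refine continuous_pi fun j => ?_
    by_cases hj : j ∈ s
    · have hcons : Continuous fun x : Fin n → ℝ =>
          (Fin.cons (1 - ∑ i, x i) x : Fin (n + 1) → ℝ) := by
        refine continuous_pi fun i => ?_
        refine Fin.cases ?_ (fun i => ?_) i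
        · simp only [Fin.cons_zero]; fun_prop
        · simp only [Fin.cons_succ]; fun_prop
      refine ((continuous_apply (e.symm ⟨j, hj⟩)).comp hcons).congr fun x => ?_
      simp [c₀, hj]
    · exact (continuous_const (y := (0 : ℝ))).congr fun x => (hout x j hj).symm
  have hd₀c : Continuous d₀ := by fun_prop
  refine ⟨c₀ ∘ φ.symm, φ ∘ d₀, hc₀c.comp φ.symm.continuous, φ.continuous.comp hd₀c,
    fun x => by simp [hdc], fun y hy => by simp [hcd y hy], fun x => ?_, fun x => ?_⟩
  · rw [Function.comp_apply, hclosed, ← hφ', φ.image_eq_preimage_symm]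
    rfl
  · rw [Function.comp_apply, hopen, ← hφ, φ.image_eq_preimage_symm]
    rfl

end CharacteristicMap

/-! ### The CW structure on the image -/

section CellStructure

variable {ι : Type u} {V : Type*} [PartialOrder V] {K : Set (Finset ι)}
  {P : Finset ι → Finset ι → Prop} {C : Set (Finset ι)} {f : Finset ι → V}
  {h : (ι → ℝ) → Finset ι → ι → ℝ}

/-- The image of a Morse map is a CW complex with cells the critical simplices. -/
theorem MorseMap.exists_cwComplex (hh : MorseMap P C K h) (G : DiscreteGradient K P C f)
    (hK : K.Finite) :
    ∃ _ : CWComplex (Set.univ : Set (h '' polyhedron K)), ∀ p : ℕ,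
      ENat.card (RelCWComplex.cell (Set.univ : Set (h '' polyhedron K)) p) =
        {s | s ∈ C ∧ s.card = p + 1}.encard := by
  let cell : ℕ → Type u := fun n => {s : Finset ι // s ∈ C ∧ s.card = n + 1}
  choose c d hc hd hdc hcd hclosed hopen using
    fun (n : ℕ) (s : cell n) => exists_ball_parametrization s.2.2
  have hsK : ∀ {n : ℕ} (s : cell n), s.1 ∈ K := fun s => G.crit_subset s.2.1
  -- A characteristic map must be total with values in the image of `h`; points outside the closed
  -- ball are sent to the centre, and their values play no role.
  let r : ∀ n : ℕ, (Fin n → ℝ) → (Fin n → ℝ) := fun n x => if x ∈ closedBall 0 1 then x else 0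
  have hr : ∀ {n : ℕ} {x : Fin n → ℝ}, x ∈ closedBall 0 1 → r n x = x := fun hx => if_pos hx
  have hrmem : ∀ (n : ℕ) (x : Fin n → ℝ), r n x ∈ closedBall 0 1 := fun n x => by
    by_cases hx : x ∈ closedBall 0 1
    · rw [hr hx]; exact hx
    · simp only [r, if_neg hx]
      exact mem_closedBall_self zero_le_one
  let χ : ∀ n : ℕ, cell n → (Fin n → ℝ) → h '' polyhedron K := fun n s x =>
    ⟨h (c n s (r n x)), _, closedSimplex_subset_polyhedron (hsK s)
      ((hclosed n s _).2 (hrmem n x)), rfl⟩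
  have hχ : ∀ {n : ℕ} (s : cell n) {x : Fin n → ℝ}, x ∈ closedBall 0 1 →
      (χ n s x : Finset ι → ι → ℝ) = h (c n s x) := fun s x hx => by
    simp only [χ, hr hx]
  -- On the open cell the coordinate `s` is `minCoord s x • x`, whose coordinate sum is `minCoord s
  -- x`; dividing by that sum recovers `x`.
  let ψ : ∀ n : ℕ, cell n → h '' polyhedron K → (Fin n → ℝ) := fun n s y =>
    d n s ((∑ i ∈ s.1, (y : Finset ι → ι → ℝ) s.1 i)⁻¹ • (y : Finset ι → ι → ℝ) s.1)
  have hχs : ∀ {n : ℕ} (s : cell n) {x : Fin n → ℝ}, x ∈ ball 0 1 →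
      (χ n s x : Finset ι → ι → ℝ) s.1 = minCoord s.1 (c n s x) • c n s x := fun s x hx => by
    rw [hχ s (ball_subset_closedBall hx)]
    exact hh.apply_crit s.2.1 (hsK s) ((hopen _ s x).2 hx).1
  have hχsum : ∀ {n : ℕ} (s : cell n) {x : Fin n → ℝ}, x ∈ ball 0 1 →
      ∑ i ∈ s.1, (χ n s x : Finset ι → ι → ℝ) s.1 i = minCoord s.1 (c n s x) := fun s x hx => by
    rw [hχs s hx]
    simp only [Pi.smul_apply, smul_eq_mul, ← Finset.mul_sum, ((hopen _ s x).2 hx).1.2.2, mul_one]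
  have hpos : ∀ {n : ℕ} (s : cell n) {x : Fin n → ℝ}, x ∈ ball 0 1 →
      minCoord s.1 (c n s x) ≠ 0 := fun s x hx =>
    (minCoord_pos (G.isComplex.nonempty (hsK s)) ((hopen _ s x).2 hx)).ne'
  have hψχ : ∀ {n : ℕ} (s : cell n) {x : Fin n → ℝ}, x ∈ ball 0 1 → ψ n s (χ n s x) = x :=
    fun s x hx => by
      simp only [ψ]
      rw [hχsum s hx, hχs s hx, inv_smul_smul₀ (hpos s hx), hdc]
  let map : ∀ n : ℕ, cell n → PartialEquiv (Fin n → ℝ) (h '' polyhedron K) := fun n s =>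
    { toFun := χ n s
      invFun := ψ n s
      source := ball 0 1
      target := χ n s '' ball 0 1
      map_source' := fun x hx => Set.mem_image_of_mem _ hx
      map_target' := by
        rintro _ ⟨x, hx, rfl⟩
        rwa [hψχ s hx]
      left_inv' := fun x hx => hψχ s hx
      right_inv' := by
        rintro _ ⟨x, hx, rfl⟩
        rw [hψχ s hx] }
  have hcover : ∀ {N : Set (Finset ι)} {x : ι → ℝ}, IsSaturated P N → N ⊆ K → x ∈ polyhedron N →
      ∃ (m : ℕ) (t : cell m), t.1 ∈ N ∧ ∃ y ∈ closedBall 0 1,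
        (χ m t y : Finset ι → ι → ℝ) = h x := by
    intro N x hN hNK hx
    obtain ⟨t, htC, htN, y, hy, hxy⟩ := hh.exists_eq hN hNK hx
    have ht : t.card = (t.card - 1) + 1 :=
      (Nat.succ_pred_eq_of_pos (hN.isComplex.nonempty htN).card_pos).symm
    let t' : cell (t.card - 1) := ⟨t, htC, ht⟩
    have hcy : c _ t' (d _ t' y) = y := hcd _ t' y hy.1
    have hmem : d _ t' y ∈ closedBall 0 1 := (hclosed _ t' _).1 (hcy.symm ▸ hy.1)
    exact ⟨_, t', htN, _, hmem, by rw [hχ t' hmem, hcy, hxy]⟩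
  refine ⟨CWComplex.mkFinite Set.univ cell map ?_ ?_ (fun n s => rfl) ?_ ?_ ?_ ?_ ?_, fun p => rfl⟩
  · obtain ⟨N, hN⟩ := (hK.image Finset.card).bddAbove
    filter_upwards [Filter.eventually_ge_atTop N] with n hn
    refine ⟨fun s => ?_⟩
    have := hN (Set.mem_image_of_mem _ (hsK s))
    have := s.2.2
    omega
  · intro n
    exact (hK.subset fun s hs => G.crit_subset hs.1 : {s | s ∈ C ∧ s.card = n + 1}.Finite)
  · intro n s
    rw [IsInducing.subtypeVal.continuousOn_iff]
    refine ContinuousOn.congr (f := fun x => h (c n s x)) ?_ fun x hx => hχ s hx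
    exact hh.continuousOn.comp (hc n s).continuousOn fun x hx =>
      closedSimplex_subset_polyhedron (hsK s) ((hclosed n s x).2 hx)
  · intro n s
    have hev : Continuous fun y : h '' polyhedron K => (y : Finset ι → ι → ℝ) s.1 :=
      (continuous_apply s.1).comp continuous_subtype_val
    refine (hd n s).comp_continuousOn (ContinuousOn.fun_smul (ContinuousOn.fun_inv₀ ?_ ?_) ?_)
    · exact (continuous_finsetSum _ fun i _ => (continuous_apply i).comp hev).continuousOn
    · rintro _ ⟨x, hx, rfl⟩
      exact (hχsum s hx).symm ▸ hpos s hx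
    · exact hev.continuousOn
  · rintro ⟨n, s⟩ - ⟨m, t⟩ - hne
    refine Set.disjoint_left.2 ?_
    rintro _ ⟨x, hx, rfl⟩ ⟨y, hy, hxy⟩
    have hst : s.1 ≠ t.1 := by
      intro hst
      have h1 := s.2.2
      have h2 := t.2.2
      obtain rfl : n = m := by rw [hst] at h1; omega
      exact hne (congrArg (Sigma.mk n) (Subtype.ext hst))
    have hxy' : (χ m t y : Finset ι → ι → ℝ) = χ n s x := congrArg Subtype.val hxy
    rw [hχ t (ball_subset_closedBall hy), hχ s (ball_subset_closedBall hx)] at hxy'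
    exact hh.disjoint s.2.1 (hsK s) t.2.1 (hsK t) hst ((hopen n s x).2 hx) ((hopen m t y).2 hy)
      hxy'.symm
  · intro n s x hx
    have hx1 : x ∈ closedBall 0 1 := sphere_subset_closedBall hx
    obtain ⟨t, hts, ht, hxt, -⟩ := exists_mem_openSimplex ((hclosed n s x).2 hx1)
    have hne : t ≠ s.1 := by
      rintro rfl
      have := (hopen n s x).1 hxt
      rw [mem_ball] at this
      rw [mem_sphere] at hx
      exact this.ne hx
    have hcard := Finset.card_lt_card (Finset.ssubset_iff_subset_ne.2 ⟨hts, hne⟩)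
    rw [s.2.2] at hcard
    -- The boundary lies in a saturated complex whose `n`-dimensional simplices are all matched with
    -- a face, so its critical simplices have dimension less than `n`.
    obtain ⟨m, t', ⟨-, ht'⟩, y, hy, hxy⟩ := hcover (x := c n s x) (G.isSaturated_skeleton n)
      (fun _ hs => hs.1) ⟨t, ⟨G.isComplex.mem_of_subset (hsK s) ht hts, .inl (by omega)⟩, hxt.1⟩
    have hm : m < n := by
      have := t'.2.2
      rcases ht' with h' | ⟨-, r, hr⟩
      · omega
      · exact absurd hr (G.crit_not_right t'.2.1)
    simp only [Set.mem_iUnion]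
    exact ⟨m, hm, t', y, hy, Subtype.ext (hxy.trans (hχ s hx1).symm)⟩
  · refine Set.eq_univ_of_forall ?_
    rintro ⟨_, x, hx, rfl⟩
    obtain ⟨m, t, -, y, hy, hxy⟩ := hcover G.isSaturated subset_rfl hx
    simp only [Set.mem_iUnion]
    exact ⟨m, t, y, hy, Subtype.ext hxy⟩

end CellStructure

theorem encard_criticalSimplices {ι : Type*} {K : PreAbstractSimplicialComplex ι} {k : ℕ}
    (hK : K.faces.Finite) (f : K → (Fin k → ℝ)) (p : ℕ) :
    {s | s ∈ criticalSimplices f ∧ s.card = p + 1}.encard = (numCritical f p : ℕ∞) := by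
  have : Finite K := hK
  rw [numCritical, Set.Finite.cast_ncard_eq (Set.toFinite _),
    ← Subtype.val_injective.encard_image]
  congr 1
  ext s
  constructor
  · rintro ⟨⟨σ, rfl, hσ⟩, hc⟩
    exact ⟨σ, ⟨hσ, hc⟩, rfl⟩
  · rintro ⟨σ, ⟨hσ, hc⟩, rfl⟩
    exact ⟨⟨σ, rfl, hσ⟩, hc⟩

end MultiMorse

theorem mainTheorem10 {ι : Type u} (K : PreAbstractSimplicialComplex ι)
    (hK : K.faces.Finite) (k : ℕ) (f : K → (Fin k → ℝ)) (hf : MultiMorse.IsMDM f) :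
    ∃ (X : Type u) (_ : TopologicalSpace X) (_ : T2Space X)
      (_ : Topology.CWComplex (Set.univ : Set X)),
      (∀ p : ℕ, ENat.card (Topology.RelCWComplex.cell (Set.univ : Set X) p) =
        (MultiMorse.numCritical f p : ℕ∞)) ∧
      Nonempty (ContinuousMap.HomotopyEquiv (MultiMorse.realization K) X) := by
  have G := hf.discreteGradient
  obtain ⟨h, hh⟩ := G.exists_morseMap hK G.isSaturated subset_rfl
  obtain ⟨cw, hcw⟩ := hh.exists_cwComplex G hK
  obtain ⟨e, -⟩ := hh.isHomotopyEquivOn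
  -- `realization K` is `polyhedron K.faces` by unfolding, so `e` has the required type.
  exact ⟨h '' MultiMorse.polyhedron K.faces, inferInstance, inferInstance, cw,
    fun p => (hcw p).trans (MultiMorse.encard_criticalSimplices hK f p), ⟨e⟩⟩
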